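/- Let $L$ be a first-order language and let $\mathbb R$ carry an o-minimal $L$-structure expanding the ordered additive group $(\mathbb R,<,+)$ (i.e. $<$ and the graph of $+$ are definable without parameters, and every subset of $\mathbb R$ definable with parameters is a finite union of points and open intervals, possibly unbounded). Let $T$ be its complete theory. For a model $M$ of $T$ and $P\subseteq M$, the pair $(M,P)$ is the expansion of $M$ to $L_P=L\cup\{P\}$ by a unary predicate. It is a *lovely pair* if $P\preceq M$ in $L$ and, for every finite $A\subseteq M$ and every non-algebraic $L$-type $q(x)\in S_1(A)$, $q$ has a realization in $P$ and $q$ has a realization in $M\setminus\operatorname{acl}(A\cup P)$. The theory $T_P$ of lovely pairs is axiomatized by the following schemes, for all $L$-formulas $\varphi(\bar x,x)$, $\psi(\bar x,\bar y,x)$ and all $k\in\mathbb N$: 1. $\forall \bar x\in P\,(\exists x\,\varphi(\bar x,x)\to(\exists x\in P)\,\varphi(\bar x,x))$; 2. $\forall\bar x\,(\exists^\infty x\,\varphi(\bar x,x)\to(\exists x\in P)\,\varphi(\bar x,x))$; 3. $\forall\bar x\,\bigl(\forall\bar y\,\exists^{<k}x\,\psi(\bar x,\bar y,x)\wedge\exists^\infty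 x\,\varphi(\bar x,x)\to\exists x\,(\varphi(\bar x,x)\wedge(\forall\bar y\in P)\,\neg\psi(\bar x,\bar y,x))\bigr)$. Let $(\mathfrak C,P)$ be a monster model of $T_P$: $\mathfrak C\models T$, $(\mathfrak C,P)\models T_P$, $\mathfrak C$ is uncountable, and $(\mathfrak C,P)$ is saturated, that is, it realizes every complete $L_P$-type in one variable over every *small* set, where small means of cardinality less than $|\mathfrak C|$. Let $o(P)$ be the set of images of $P$ under automorphisms of the $L$-structure $\mathfrak C$, and let $e(P)=\{P'\subseteq\mathfrak C : (\mathfrak C,P)\equiv(\mathfrak C,P')\}$. For $Q\subseteq\mathfrak C$, the codimension of $Q$ is the cardinality of an $\operatorname{acl}$-basis of $\mathfrak C$ over $Q$. Then: - $o(P)\neq e(P)$. - For every cardinal $\kappa$ with $\aleph_0\le\kappa<|\mathfrak C|$ there is an algebraically closed $P'\subseteq\mathfrak C$ with $P\subseteq P'$ of codimension $\kappa$. - For every algebraically closed $P'$ with $P\subseteq P'\subseteq\mathfrak C$ whose codimension is infinite and small: $P'$ is co-dense (every interval $(a,b)$ of $\mathfrak C$ with $a<b$ contains a point outside $P'$),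 $(\mathfrak C,P')$ is a lovely pair, $(\mathfrak C,P')\equiv(\mathfrak C,P)$, and $(\mathfrak C,P')\not\cong(\mathfrak C,P)$. -/

import Mathlib

open FirstOrder FirstOrder.Language Cardinal

universe u v w

namespace LovelyPairs

/-! ### O-minimal structures -/

/-- Points, open intervals with endpoints in the line, open rays, and the whole line. -/
def IsPointOrInterval {M : Type w} [LinearOrder M] (S : Set M) : Prop :=
  (∃ a, S = {a}) ∨ (∃ a b, S = Set.Ioo a b) ∨ (∃ a, S = Set.Iio a) ∨ (∃ a, S = Set.Ioi a) ∨
    S = Set.univ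

/-- An `L`-structure on a linear order is o-minimal if every subset of the line that is definable
with parameters is a finite union of points and open intervals. -/
def IsOMinimal (L : FirstOrder.Language.{u, v}) (M : Type w) [LinearOrder M] [L.Structure M] : Prop :=
  ∀ S : Set M, (Set.univ : Set M).Definable₁ L S →
    ∃ F : Set (Set M), F.Finite ∧ (∀ I ∈ F, IsPointOrInterval I) ∧ S = ⋃₀ F

/-! ### Algebraic closure and codimension -/

section Acl

variable (L : FirstOrder.Language.{u, v}) {M : Type w} [L.Structure M]

/-- The (model-theoretic) algebraic closure of `B`: the union of all finite sets definable over
`B`. -/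
def acl (B : Set M) : Set M :=
  {a | ∃ S : Set M, S.Finite ∧ B.Definable₁ L S ∧ a ∈ S}

/-- `Q` is algebraically closed. -/
def IsAlgClosedSet (Q : Set M) : Prop := acl L Q = Q

/-- `κ` is the codimension of `Q` in `M`, that is, the dimension of `M` over `Q` with respect to
algebraic closure: the cardinality of a basis of `M` over `Q`. (When algebraic closure has the
exchange property, all bases have the same cardinality.) -/
def HasCodim (Q : Set M) (κ : Cardinal.{w}) : Prop :=
  ∃ B : Set M, #B = κ ∧ acl L (Q ∪ B) = Set.univ ∧ ∀ b ∈ B, b ∉ acl L (Q ∪ (B \ {b}))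

end Acl

/-! ### Complete types over sets of parameters -/

section Types

variable (L : FirstOrder.Language.{u, v}) {M : Type w} [L.Structure M]

/-- `S₁(A)`: the complete 1-types over `A` (in the sense of the structure `M`). -/
abbrev OneType (A : Set M) : Type _ :=
  ((L[[A]]).completeTheory M).CompleteType (Fin 1)

variable {L}

/-- The element `a` of `M` realizes the type `q` over `A`. -/
def OneType.RealizedBy {A : Set M} (q : OneType L A) (a : M) : Prop :=
  ∀ φ : (L[[A]]).Formula (Fin 1), Formula.equivSentence φ ∈ q → φ.Realize (fun _ => a)

/-- A type over `A` is non-algebraic if each of its formulas has infinitely many solutions. -/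
def OneType.IsNonalgebraic {A : Set M} (q : OneType L A) : Prop :=
  ∀ φ : (L[[A]]).Formula (Fin 1), Formula.equivSentence φ ∈ q →
    {a : M | φ.Realize (fun _ => a)}.Infinite

end Types

/-- `M` is saturated: all complete types over all small sets of parameters (that is, sets of
cardinality smaller than that of `M`) are realized in `M`. -/
def IsSaturated (L : FirstOrder.Language.{u, v}) (M : Type w) [L.Structure M] : Prop :=
  ∀ A : Set M, #A < #M → ∀ q : OneType L A, ∃ a : M, q.RealizedBy a

/-! ### Pairs: expansions by a unary predicate -/

/-- The only relation symbol of `predLang`, a unary one. -/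
inductive PredSymb : ℕ → Type
  | P : PredSymb 1

/-- The language with a single unary predicate symbol `P`. -/
def predLang : FirstOrder.Language.{0, 0} := ⟨fun _ => Empty, PredSymb⟩

/-- The language `L_P = L ∪ {P}`. -/
abbrev pairLang (L : FirstOrder.Language.{u, v}) : FirstOrder.Language := L.sum predLang

/-- The expansion `(M, Q)` of `M` in which the predicate symbol `P` is interpreted as `Q`
(a copy of the type `M`). -/
def Pair {M : Type w} (_Q : Set M) : Type w := M

instance Pair.structure {L : FirstOrder.Language.{u, v}} {M : Type w} [s : L.Structure M] (Q : Set M) :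
    L.Structure (Pair Q) := s

instance Pair.predStructure {M : Type w} (Q : Set M) : predLang.Structure (Pair Q) where
  funMap := fun f => nomatch f
  RelMap := fun {_} r => match r with
    | PredSymb.P => fun x => (show M from x 0) ∈ Q

section Pairs

variable (L : FirstOrder.Language.{u, v}) {M : Type w} [L.Structure M]

/-- `o(Q)`: the set of images of `Q` under automorphisms of the `L`-structure `M`. -/
def orbit (Q : Set M) : Set (Set M) :=
  {Q' | ∃ f : M ≃[L] M, f '' Q = Q'}

/-- `e(Q)`: the set of all `Q'` such that `(M, Q)` and `(M, Q')` are elementarily equivalent. -/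
def elemClass (Q : Set M) : Set (Set M) :=
  {Q' | Pair Q ≅[pairLang L] Pair Q'}

/-- `(M, Q)` and `(M, Q')` are isomorphic `L_P`-structures. -/
def PairIso (Q Q' : Set M) : Prop :=
  Nonempty (Pair Q ≃[pairLang L] Pair Q')

/-- `(M, Q)` is a lovely pair. -/
structure IsLovelyPair (Q : Set M) : Prop where
  /-- `Q` is (the universe of) an elementary substructure of `M`. -/
  elementary : ∃ S : L.ElementarySubstructure M, (S : Set M) = Q
  /-- Coheir property. -/
  coheir : ∀ A : Set M, A.Finite → ∀ q : OneType L A, q.IsNonalgebraic →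
    ∃ a ∈ Q, q.RealizedBy a
  /-- Extension property. -/
  extension : ∀ A : Set M, A.Finite → ∀ q : OneType L A, q.IsNonalgebraic →
    ∃ a : M, a ∉ acl L (A ∪ Q) ∧ q.RealizedBy a

/-- `(M, Q)` is a model of the theory `T_P` of lovely pairs: it satisfies each instance of its
three axiom schemes (for all formulas `φ`, `ψ` of `L` and all `n`, `m`, `k`). -/
structure ModelsLovelyTheory (Q : Set M) : Prop where
  /-- `∀ x₁ … xₙ ∈ P (∃ x φ(x₁, …, xₙ, x) → ∃ x ∈ P φ(x₁, …, xₙ, x))`. -/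
  elementary : ∀ (n : ℕ) (φ : L.Formula (Fin n ⊕ Unit)) (x : Fin n → M), (∀ i, x i ∈ Q) →
    (∃ a : M, φ.Realize (Sum.elim x fun _ => a)) →
      ∃ a ∈ Q, φ.Realize (Sum.elim x fun _ => a)
  /-- `∀ x₁ … xₙ (∃^∞ x φ(x₁, …, xₙ, x) → ∃ x ∈ P φ(x₁, …, xₙ, x))`. -/
  density : ∀ (n : ℕ) (φ : L.Formula (Fin n ⊕ Unit)) (x : Fin n → M),
    {a : M | φ.Realize (Sum.elim x fun _ => a)}.Infinite →
      ∃ a ∈ Q, φ.Realize (Sum.elim x fun _ => a)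
  /-- `∀ x₁ … xₙ (∀ y₁ … yₘ ∃^{<k} x ψ(x₁, …, xₙ, y₁, …, yₘ, x) ∧ ∃^∞ x φ(x₁, …, xₙ, x) →
  ∃ x (φ(x₁, …, xₙ, x) ∧ ∀ y₁ … yₘ ∈ P ¬ ψ(x₁, …, xₙ, y₁, …, yₘ, x)))`. -/
  extension : ∀ (n m k : ℕ) (φ : L.Formula (Fin n ⊕ Unit)) (ψ : L.Formula ((Fin n ⊕ Fin m) ⊕ Unit))
    (x : Fin n → M),
    (∀ y : Fin m → M,
      {a : M | ψ.Realize (Sum.elim (Sum.elim x y) fun _ => a)}.encard < (k : ℕ∞)) →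
    {a : M | φ.Realize (Sum.elim x fun _ => a)}.Infinite →
      ∃ a : M, φ.Realize (Sum.elim x fun _ => a) ∧
        ∀ y : Fin m → M, (∀ i, y i ∈ Q) → ¬ ψ.Realize (Sum.elim (Sum.elim x y) fun _ => a)

/-- `(M, Q)` is a monster model of the theory of lovely pairs: a saturated model of it of
uncountable cardinality. The usual choices (a saturated model whose cardinality is strongly
inaccessible, or a proper class sized model) are special cases. -/
structure IsMonsterLovelyPair (Q : Set M) : Prop where
  models : ModelsLovelyTheory L Q
  uncountable : ℵ₀ < #M
  saturated : IsSaturated (pairLang L) (Pair Q)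

variable {L}

/-- `Q` is co-dense: each interval with endpoints `a < b` contains a point outside `Q`, where the
order on `M` is the one defined by the formula `lt`. -/
def IsCodense (lt : L.Formula (Fin 2)) (Q : Set M) : Prop :=
  ∀ a b : M, lt.Realize ![a, b] → ∃ c : M, lt.Realize ![a, c] ∧ lt.Realize ![c, b] ∧ c ∉ Q

end Pairs

end LovelyPairs

/-! The heart of the matter is that a closed `P' ⊇ P` of infinite codimension is again the predicate
of a lovely pair. The coheir property passes from `P` to any larger set. For the extension property,
let `q` be a nonalgebraic type over a finite `A`. Infinite codimension gives one element `b` outside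
`acl (A ∪ P')`. The translated type `{x : b + x ⊨ q}` is again nonalgebraic, so saturation realizes
it by some `p` in `P`. Then `s = b + p` realizes `q`, and `s ∉ acl (A ∪ P')`, since otherwise `b = s
- p` would lie there too. Thus addition moves a single independent element into every nonalgebraic
type (`isRich_of_subset`).

Any two such predicates on the same structure are elementarily equivalent by back-and-forth
(`elementarilyEquivalent_of_isRich`). Positions are finite tuples of the same type, generated on
each side by a part inside the predicate and a part independent over it; exchange makes membership
in the predicate visible in the `L`-type (`IsSpanned.mem_iff`).

Codimension distinguishes them up to isomorphism. By saturation no small set spans `C` over `P`,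
whereas a small basis spans it over `P'`. Sets `P'` of codimension `κ` arise from a basis of `C`
over `P` by leaving out `κ` elements and closing the rest together with `P`. Exchange, needed
throughout, is read off from the pair itself (`hasExchange_of_isSaturated`). A `P'` of codimension
`ℵ₀` then separates `e(P)` from `o(P)`. -/

namespace LovelyPairs

/-! ### Algebraic closure: uniform witnesses, finite character, idempotence. -/

section AlgebraicClosure

variable {L : FirstOrder.Language.{u, v}} {M : Type w} [L.Structure M]

/-- Trades a parameter set for a tuple enumerating it, so that the same formula can later be
evaluated at other tuples. -/
theorem definable_range_iff {ι β : Type*} {a : ι → M} {s : Set (β → M)} :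
    (Set.range a).Definable L s ↔
      ∃ φ : L.Formula (ι ⊕ β), s = {v | φ.Realize (Sum.elim a v)} := by
  rw [Set.definable_iff_exists_formula_sum]
  constructor
  · rintro ⟨φ, rfl⟩
    refine ⟨φ.relabel (Sum.map (fun y => y.2.choose) id), ?_⟩
    ext v
    simp only [Set.mem_ofPred_eq, Formula.realize_relabel]
    have : (Sum.elim a v ∘ Sum.map (fun y : Set.range a => y.2.choose) id) =
        Sum.elim (↑) v := by
      ext (x | x)
      · exact x.2.choose_spec
      · rfl
    rw [this]
  · rintro ⟨φ, rfl⟩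
    refine ⟨φ.relabel (Sum.map (Set.rangeFactorization a) id), ?_⟩
    ext v
    simp only [Set.mem_ofPred_eq, Formula.realize_relabel]
    have : (Sum.elim (↑) v ∘ Sum.map (Set.rangeFactorization a) id) = Sum.elim a v := by
      ext (x | x) <;> rfl
    rw [this]

theorem definable₁_iff_unit {A : Set M} {S : Set M} :
    A.Definable₁ L S ↔ A.Definable L {x : Unit → M | x () ∈ S} := by
  constructor
  · intro h
    exact Set.Definable.preimage_comp (fun _ : Fin 1 => ()) h
  · intro h
    exact Set.Definable.preimage_comp (fun _ : Unit => (0 : Fin 1)) h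

theorem definable₁_range_iff {ι : Type*} {a : ι → M} {S : Set M} :
    (Set.range a).Definable₁ L S ↔
      ∃ φ : L.Formula (ι ⊕ Unit), S = {x | φ.Realize (Sum.elim a fun _ => x)} := by
  rw [definable₁_iff_unit, definable_range_iff]
  refine exists_congr fun φ => ?_
  constructor
  · intro h
    ext x
    exact Set.ext_iff.1 h fun _ => x
  · rintro rfl
    rfl

/-- For each formula there is a formula expressing that it has at least `k` solutions. -/
theorem exists_formula_le_encard {ι : Type*} (φ : L.Formula (ι ⊕ Unit)) (k : ℕ) :
    ∃ θ : L.Formula ι, ∀ y : ι → M,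
      θ.Realize y ↔ (k : ℕ∞) ≤ {x : M | φ.Realize (Sum.elim y fun _ => x)}.encard := by
  refine ⟨Formula.iExs (Fin k)
    (Formula.iInf (fun i : Fin k => φ.relabel (Sum.map id fun _ => i)) ⊓
      Formula.iInf fun p : {p : Fin k × Fin k // p.1 ≠ p.2} =>
        ∼(Term.equal (Term.var (Sum.inr p.1.1)) (Term.var (Sum.inr p.1.2)))), fun y => ?_⟩
  have key : ∀ (i : Fin k → M) (j : Fin k),
      Sum.elim y i ∘ Sum.map id (fun _ : Unit => j) = Sum.elim y fun _ => i j := by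
    intro i j
    ext (x | x) <;> rfl
  simp only [Formula.realize_iExs, Formula.realize_inf, Formula.realize_iInf,
    Formula.realize_relabel, Formula.realize_not, Formula.realize_equal, Term.realize_var,
    Sum.elim_inr, key]
  constructor
  · rintro ⟨f, hf, hinj⟩
    have hf' : Function.Injective f := by
      intro i j hij
      by_contra hne
      exact hinj ⟨(i, j), hne⟩ hij
    calc (k : ℕ∞) = (Set.range f).encard := by
          rw [← Set.image_univ, hf'.injOn.encard_image]
          simp
      _ ≤ _ := Set.encard_le_encard (by rintro _ ⟨i, rfl⟩; exact hf i)
  · intro h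
    obtain ⟨t, ht, htk⟩ := Set.exists_subset_encard_eq h
    have hfin : t.Finite := Set.finite_of_encard_eq_coe htk
    have hcard : Nat.card t = k := by
      have := hfin.cast_ncard_eq
      rw [htk] at this
      exact_mod_cast this
    have := hfin.to_subtype
    let e := Finite.equivFinOfCardEq hcard
    refine ⟨fun i => e.symm i, fun i => ht (e.symm i).2, fun p hp => p.2 ?_⟩
    exact e.symm.injective (Subtype.ext hp)

theorem mem_acl_range_iff {ι : Type*} {a : ι → M} {c : M} :
    c ∈ acl L (Set.range a) ↔ ∃ φ : L.Formula (ι ⊕ Unit),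
      {x : M | φ.Realize (Sum.elim a fun _ => x)}.Finite ∧ φ.Realize (Sum.elim a fun _ => c) := by
  constructor
  · rintro ⟨S, hS, hd, hc⟩
    obtain ⟨φ, rfl⟩ := definable₁_range_iff.1 hd
    exact ⟨φ, hS, hc⟩
  · rintro ⟨φ, hS, hc⟩
    exact ⟨_, hS, definable₁_range_iff.2 ⟨φ, rfl⟩, hc⟩

/-- Algebraicity is witnessed by a formula whose fibres have uniformly bounded size. -/
theorem mem_acl_range_iff_uniform {ι : Type*} {a : ι → M} {c : M} :
    c ∈ acl L (Set.range a) ↔ ∃ (φ : L.Formula (ι ⊕ Unit)) (k : ℕ),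
      (∀ y : ι → M, {x : M | φ.Realize (Sum.elim y fun _ => x)}.encard < (k : ℕ∞)) ∧
        φ.Realize (Sum.elim a fun _ => c) := by
  rw [mem_acl_range_iff]
  constructor
  · rintro ⟨φ, hfin, hc⟩
    obtain ⟨n, hn⟩ := hfin.exists_encard_eq_coe
    obtain ⟨θ, hθ⟩ := exists_formula_le_encard (M := M) φ (n + 1)
    have key : ∀ y : ι → M, ∀ x : M,
        (φ ⊓ ∼(θ.relabel Sum.inl)).Realize (Sum.elim y fun _ : Unit => x) ↔
          φ.Realize (Sum.elim y fun _ => x) ∧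
            {x : M | φ.Realize (Sum.elim y fun _ => x)}.encard < ((n + 1 : ℕ) : ℕ∞) := by
      intro y x
      rw [Formula.realize_inf, Formula.realize_not, Formula.realize_relabel, Sum.elim_comp_inl,
        hθ, not_le]
    -- Conjoining "at most `n` solutions" leaves the fibre over `a` unchanged and empties every
    -- larger fibre. The strict bound `n + 1` covers the empty fibres too.
    refine ⟨φ ⊓ ∼(θ.relabel Sum.inl), n + 1, fun y => ?_, (key _ _).2 ⟨hc, ?_⟩⟩
    · by_cases hy : {x : M | φ.Realize (Sum.elim y fun _ => x)}.encard < ((n + 1 : ℕ) : ℕ∞)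
      · exact (Set.encard_le_encard fun x hx => ((key y x).1 hx).1).trans_lt hy
      · have : {x : M | (φ ⊓ ∼(θ.relabel Sum.inl)).Realize (Sum.elim y fun _ : Unit => x)} = ∅ :=
          Set.eq_empty_of_forall_notMem fun x hx => hy ((key y x).1 hx).2
        rw [this, Set.encard_empty]
        exact_mod_cast Nat.succ_pos n
    · rw [hn]
      exact_mod_cast Nat.lt_succ_self n
  · rintro ⟨φ, k, hk, hc⟩
    exact ⟨φ, Set.finite_of_encard_le_coe (hk a).le, hc⟩

variable (L) in
theorem acl_mono {A B : Set M} (h : A ⊆ B) : acl L A ⊆ acl L B := by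
  rintro c ⟨S, hS, hd, hc⟩
  exact ⟨S, hS, hd.mono h, hc⟩

variable (L) in
theorem subset_acl (A : Set M) : A ⊆ acl L A := by
  intro c hc
  refine ⟨{c}, Set.finite_singleton c, ?_, rfl⟩
  rw [definable₁_iff_unit]
  obtain ⟨φ, hφ⟩ : ∃ φ : L.Formula (A ⊕ Unit), ∀ x : M,
      φ.Realize (Sum.elim (↑) fun _ => x) ↔ x = c :=
    ⟨Term.equal (Term.var (Sum.inr ())) (Term.var (Sum.inl ⟨c, hc⟩)), fun x => by simp⟩
  rw [Set.definable_iff_exists_formula_sum]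
  exact ⟨φ, Set.ext fun x => ((hφ (x ())).symm : _)⟩

theorem exists_finset_mem_acl {A : Set M} {c : M} (h : c ∈ acl L A) :
    ∃ F : Finset M, (F : Set M) ⊆ A ∧ c ∈ acl L (F : Set M) := by
  obtain ⟨S, hS, hd, hc⟩ := h
  obtain ⟨F, hF, hd⟩ := Set.definable_iff_finitely_definable.1 hd
  exact ⟨F, hF, S, hS, hd, hc⟩

/-- If `c` is algebraic over `A` and an algebraic element `b` over `A`, it is algebraic over
`A`. -/
theorem mem_acl_of_mem_acl_insert {A : Set M} {b c : M} (hb : b ∈ acl L A)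
    (hc : c ∈ acl L (insert b A)) : c ∈ acl L A := by
  have hr : insert b A = Set.range (Sum.elim ((↑) : A → M) fun _ : Unit => b) := by
    rw [Set.Sum.elim_range, Subtype.range_coe, Set.range_const, Set.union_singleton]
  rw [hr, mem_acl_range_iff_uniform] at hc
  obtain ⟨φ, k, hk, hc⟩ := hc
  have hb' := hb
  rw [← Subtype.range_coe (s := A), mem_acl_range_iff] at hb'
  obtain ⟨ψ, hψ, hb'⟩ := hb'
  rw [← Subtype.range_coe (s := A), mem_acl_range_iff]
  -- The parameter `b` is quantified away over the finite set of solutions of `ψ`; uniform bounds on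
  -- `φ` make the union of the fibres finite.
  let χ : L.Formula ((A ⊕ Unit) ⊕ Unit) :=
    (φ.relabel (Sum.elim (Sum.elim (fun i => Sum.inl (Sum.inl i)) fun _ => Sum.inr ())
      fun _ => Sum.inl (Sum.inr ()))) ⊓ (ψ.relabel (Sum.map Sum.inl id))
  have key : ∀ x : M, (χ.iExs Unit).Realize (Sum.elim ((↑) : A → M) fun _ => x) ↔
      ∃ y : M, φ.Realize (Sum.elim (Sum.elim ((↑) : A → M) fun _ => y) fun _ => x) ∧
        ψ.Realize (Sum.elim ((↑) : A → M) fun _ => y) := by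
    intro x
    rw [Formula.realize_iExs]
    constructor
    · rintro ⟨y, hy⟩
      rw [Formula.realize_inf, Formula.realize_relabel, Formula.realize_relabel] at hy
      refine ⟨y (), ?_, ?_⟩
      · convert hy.1 using 1
        ext ((i | i) | i) <;> rfl
      · convert hy.2 using 1
        ext (i | i) <;> rfl
    · rintro ⟨y, hy⟩
      refine ⟨fun _ => y, ?_⟩
      rw [Formula.realize_inf, Formula.realize_relabel, Formula.realize_relabel]
      refine ⟨?_, ?_⟩
      · convert hy.1 using 1
        ext ((i | i) | i) <;> rfl
      · convert hy.2 using 1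
        ext (i | i) <;> rfl
  refine ⟨χ.iExs Unit, ?_, (key c).2 ⟨b, hc, hb'⟩⟩
  refine (hψ.biUnion fun y _ => Set.finite_of_encard_le_coe
    (hk (Sum.elim ((↑) : A → M) fun _ => y)).le).subset fun x hx => ?_
  obtain ⟨y, hy, hy'⟩ := (key x).1 hx
  exact Set.mem_biUnion (show y ∈ {y | _} from hy') hy

/-- By finite character only finitely many elements of `A` matter, and they are discharged one at a
time. -/
theorem acl_subset_acl {A B : Set M} (h : A ⊆ acl L B) : acl L A ⊆ acl L B := by
  classical
  intro c hc
  obtain ⟨F, hF, hc⟩ := exists_finset_mem_acl hc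
  have hF' := hF.trans h
  clear hF
  replace hc : c ∈ acl L (B ∪ F) := acl_mono L Set.subset_union_right hc
  induction F using Finset.induction_on with
  | empty => simpa using hc
  | insert b F _ ih =>
    rw [Finset.coe_insert, Set.insert_subset_iff] at hF'
    refine ih hF'.2 (mem_acl_of_mem_acl_insert (acl_mono L Set.subset_union_left hF'.1) ?_)
    rwa [Finset.coe_insert, Set.union_insert] at hc

variable (L) in
theorem isAlgClosedSet_acl (A : Set M) : IsAlgClosedSet L (acl L A) :=
  (acl_subset_acl subset_rfl).antisymm (subset_acl L _)

/-- Tuples of the same type satisfy the same algebraic dependences. -/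
theorem mem_acl_image_of_realize_iff {α : Type*} {a b : α → M}
    (h : ∀ φ : L.Formula α, φ.Realize a ↔ φ.Realize b) {J : Set α} {i : α}
    (hi : a i ∈ acl L (a '' J)) : b i ∈ acl L (b '' J) := by
  rw [Set.image_eq_range, mem_acl_range_iff_uniform] at hi ⊢
  obtain ⟨φ, k, hk, hi⟩ := hi
  refine ⟨φ, k, hk, ?_⟩
  have key : ∀ c : α → M, (φ.relabel (Sum.elim ((↑) : J → α) fun _ => i)).Realize c ↔
      φ.Realize (Sum.elim (fun j : J => c j) fun _ => c i) := by
    intro c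
    rw [Formula.realize_relabel]
    have : c ∘ Sum.elim ((↑) : J → α) (fun _ : Unit => i) =
        Sum.elim (fun j : J => c j) fun _ => c i := by
      ext (x | x) <;> rfl
    rw [this]
  exact (key b).1 ((h _).1 ((key a).2 hi))

theorem exists_formula_fin {A : Set M} {S : Set M} (h : A.Definable₁ L S) :
    ∃ (n : ℕ) (φ : L.Formula (Fin n ⊕ Unit)) (x : Fin n → M), (∀ i, x i ∈ A) ∧
      S = {c | φ.Realize (Sum.elim x fun _ => c)} := by
  obtain ⟨F, hF, hd⟩ := Set.definable_iff_finitely_definable.1 h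
  let e := F.equivFin
  have hr : (F : Set M) = Set.range fun i => (e.symm i : M) := by
    ext x
    constructor
    · intro hx
      exact ⟨e ⟨x, hx⟩, by simp⟩
    · rintro ⟨i, rfl⟩
      exact (e.symm i).2
  have hd' : (F : Set M).Definable₁ L S := hd
  rw [hr, definable₁_range_iff] at hd'
  obtain ⟨φ, hφ⟩ := hd'
  exact ⟨_, φ, _, fun i => hF (e.symm i).2, hφ⟩

end AlgebraicClosure

/-! ### Saturation for directed families of definable sets. -/

section Saturation

variable {L : FirstOrder.Language.{u, v}} {M : Type w} [L.Structure M]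

/-- Directedness and nonemptiness make the family finitely satisfiable together with the complete
theory. Compactness extends it to a complete type, to which saturation applies. -/
theorem IsSaturated.exists_forall_mem (h : IsSaturated L M) {A : Set M} (hA : #A < #M)
    {ι : Type*} [Nonempty ι] {S : ι → Set M} (hdir : Directed (· ⊇ ·) S)
    (hS : ∀ i, A.Definable₁ L (S i)) (hne : ∀ i, (S i).Nonempty) : ∃ a, ∀ i, a ∈ S i := by
  classical
  have : Nonempty M := (hne (Classical.arbitrary ι)).to_type
  have hφ : ∀ i, ∃ φ : (L[[A]]).Formula (Fin 1), ∀ a : M, a ∈ S i ↔ φ.Realize fun _ => a := by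
    intro i
    obtain ⟨φ, hφ⟩ := hS i
    exact ⟨φ, fun a => Set.ext_iff.1 hφ fun _ => a⟩
  choose φ hφ using hφ
  let T := (L[[A]]).completeTheory M
  have hsat : (((L[[A]]).lhomWithConstants (Fin 1)).onTheory T ∪
      Set.range fun i => Formula.equivSentence (φ i)).IsSatisfiable := by
    rw [Theory.isSatisfiable_iff_isFinitelySatisfiable]
    intro T₀ hT₀
    -- Each sentence of `T₀` outside the theory gets the index of a formula it comes from; the
    -- others get an arbitrary index.
    have hind : ∀ σ ∈ T₀, ∃ i, σ ∉ ((L[[A]]).lhomWithConstants (Fin 1)).onTheory T →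
        σ = Formula.equivSentence (φ i) := by
      intro σ hσ
      rcases hT₀ hσ with h | ⟨i, rfl⟩
      · exact ⟨Classical.arbitrary ι, fun h' => (h' h).elim⟩
      · exact ⟨i, fun _ => rfl⟩
    choose! g hg using hind
    obtain ⟨z, hz⟩ := hdir.finset_le (T₀.image g)
    obtain ⟨a, ha⟩ := hne z
    let _ : (constantsOn (Fin 1)).Structure M := constantsOn.structure fun _ => a
    have hM : M ⊨ ((L[[A]]).lhomWithConstants (Fin 1)).onTheory T :=
      (LHom.onTheory_model _ _).2 inferInstance
    have : M ⊨ (T₀ : ((L[[A]])[[Fin 1]]).Theory) := by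
      refine ⟨fun σ hσ => ?_⟩
      by_cases hσT : σ ∈ ((L[[A]]).lhomWithConstants (Fin 1)).onTheory T
      · exact hM.realize_of_mem σ hσT
      · rw [hg σ hσ hσT]
        have := (hφ _ a).1 (hz (g σ) (Finset.mem_image_of_mem g hσ) ha)
        exact (Formula.realize_equivSentence M _).2 this
    exact Theory.Model.isSatisfiable M
  obtain ⟨p, hp⟩ : {p : T.CompleteType (Fin 1) |
      (Set.range fun i => Formula.equivSentence (φ i)) ⊆ (p : ((L[[A]])[[Fin 1]]).Theory)}.Nonempty := by
    rw [Set.nonempty_iff_ne_empty, Ne, Theory.CompleteType.setOfPred_subset_eq_empty_iff, not_not]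
    exact hsat
  obtain ⟨a, ha⟩ := h A hA p
  exact ⟨a, fun i => (hφ i a).2 (ha _ (hp ⟨i, rfl⟩))⟩

/-- A complete type, viewed as a directed family of definable sets. -/
def OneType.sets {A : Set M} (q : OneType L A)
    (φ : {φ : (L[[A]]).Formula (Fin 1) // Formula.equivSentence φ ∈ q}) : Set M :=
  {a | φ.1.Realize fun _ => a}

theorem OneType.definable₁_sets {A : Set M} (q : OneType L A)
    (φ : {φ : (L[[A]]).Formula (Fin 1) // Formula.equivSentence φ ∈ q}) :
    A.Definable₁ L (q.sets φ) := by
  refine ⟨φ.1, ?_⟩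
  ext x
  have : x = fun _ => x 0 := funext fun i => by rw [Subsingleton.elim i 0]
  rw [this]
  rfl

theorem OneType.directed_sets {A : Set M} (q : OneType L A) : Directed (· ⊇ ·) q.sets := by
  intro φ ψ
  have hmem : Formula.equivSentence (φ.1 ⊓ ψ.1) ∈ q := by
    rw [Formula.equivSentence_inf]
    have := Set.ext_iff.1 (Theory.CompleteType.typesWith_inf
      (T := (L[[A]]).completeTheory M) (Formula.equivSentence φ.1) (Formula.equivSentence ψ.1)) q
    exact this.2 ⟨φ.2, ψ.2⟩
  refine ⟨⟨φ.1 ⊓ ψ.1, hmem⟩, fun a ha => ?_, fun a ha => ?_⟩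
  · exact (Formula.realize_inf.1 ha).1
  · exact (Formula.realize_inf.1 ha).2

instance {A : Set M} (q : OneType L A) :
    Nonempty {φ : (L[[A]]).Formula (Fin 1) // Formula.equivSentence φ ∈ q} := by
  rcases q.mem_or_not_mem (Formula.equivSentence ⊤) with h | h
  · exact ⟨⟨_, h⟩⟩
  · rw [← Formula.equivSentence_not] at h
    exact ⟨⟨_, h⟩⟩

end Saturation

/-! ### The axioms of lovely pairs in terms of definable sets. -/

section LovelyTheory

variable {L : FirstOrder.Language.{u, v}} {M : Type w} [L.Structure M] {Q : Set M}

theorem ModelsLovelyTheory.exists_mem_of_subset (h : ModelsLovelyTheory L Q) {A S : Set M}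
    (hA : A ⊆ Q) (hS : A.Definable₁ L S) (hne : S.Nonempty) : ∃ p ∈ Q, p ∈ S := by
  obtain ⟨n, φ, x, hx, rfl⟩ := exists_formula_fin hS
  exact h.elementary n φ x (fun i => hA (hx i)) hne

theorem ModelsLovelyTheory.exists_mem_of_infinite (h : ModelsLovelyTheory L Q) {A S : Set M}
    (hS : A.Definable₁ L S) (hinf : S.Infinite) : ∃ p ∈ Q, p ∈ S := by
  obtain ⟨n, φ, x, -, rfl⟩ := exists_formula_fin hS
  exact h.density n φ x hinf

/-- If a finite `Q`-definable set had a point outside `Q`, removing its finitely many points in `Q`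
would leave a nonempty `Q`-definable set missing `Q`, against elementarity. -/
theorem ModelsLovelyTheory.isAlgClosedSet (h : ModelsLovelyTheory L Q) : IsAlgClosedSet L Q := by
  refine Set.Subset.antisymm ?_ (subset_acl L Q)
  rintro c ⟨S, hS, hd, hc⟩
  by_contra hcQ
  have hd' : Q.Definable₁ L (S \ Q) := by
    have hfin : (S ∩ Q).Finite := hS.inter_of_left Q
    have : S \ Q = S \ ⋃ p ∈ hfin.toFinset, {p} := by
      ext x
      simp +contextual
    rw [this, definable₁_iff_unit]
    refine (definable₁_iff_unit.1 hd).sdiff ?_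
    change Q.Definable L {x : Unit → M | x () ∈ ⋃ p ∈ hfin.toFinset, {p}}
    have : {x : Unit → M | x () ∈ ⋃ p ∈ hfin.toFinset, {p}} =
        ⋃ p ∈ hfin.toFinset, {x : Unit → M | x () = p} := by
      ext x
      simp
    rw [this]
    have hp : ∀ p : hfin.toFinset, Q.Definable L {x : Unit → M | x () = p.1} := by
      intro p
      have hpQ : p.1 ∈ Q := (hfin.mem_toFinset.1 p.2).2
      rw [Set.definable_iff_exists_formula_sum]
      refine ⟨Term.equal (Term.var (Sum.inr ())) (Term.var (Sum.inl ⟨p, hpQ⟩)), ?_⟩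
      ext x
      simp
    have := Set.definable_iUnion_of_finite hp
    convert this using 1
    ext x
    simp
  obtain ⟨p, hp, -, hpQ⟩ := h.exists_mem_of_subset subset_rfl hd' ⟨c, hc, hcQ⟩
  exact hpQ hp

/-- Only finitely many variables occur in a formula, which gives it the shape of the third axiom
scheme. Injectivity of `g` lets values of the retained variables be extended to all of `ι`. -/
theorem exists_formula_fin_fin {κ ι : Type*} (ψ : L.Formula ((κ ⊕ ι) ⊕ Unit)) :
    ∃ (n m : ℕ) (f : Fin n → κ) (g : Fin m → ι) (ψ' : L.Formula ((Fin n ⊕ Fin m) ⊕ Unit)),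
      Function.Injective g ∧ ∀ (a : κ → M) (y : ι → M) (x : M),
        ψ.Realize (Sum.elim (Sum.elim a y) fun _ => x) ↔
          ψ'.Realize (Sum.elim (Sum.elim (a ∘ f) (y ∘ g)) fun _ => x) := by
  classical
  let F := ψ.freeVarFinset
  let Fκ := F.preimage (fun i => Sum.inl (Sum.inl i)) (by intro a _ b _ h; simpa using h)
  let Fι := F.preimage (fun i => Sum.inl (Sum.inr i)) (by intro a _ b _ h; simpa using h)
  let r : F → (Fin Fκ.card ⊕ Fin Fι.card) ⊕ Unit := fun z => match z with
    | ⟨Sum.inl (Sum.inl i), h⟩ => Sum.inl (Sum.inl (Fκ.equivFin ⟨i, Finset.mem_preimage.2 h⟩))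
    | ⟨Sum.inl (Sum.inr i), h⟩ => Sum.inl (Sum.inr (Fι.equivFin ⟨i, Finset.mem_preimage.2 h⟩))
    | ⟨Sum.inr _, _⟩ => Sum.inr ()
  refine ⟨_, _, fun i => (Fκ.equivFin.symm i).1, fun i => (Fι.equivFin.symm i).1,
    ψ.restrictFreeVar r, ?_, ?_⟩
  · intro i j hij
    exact Fι.equivFin.symm.injective (Subtype.ext hij)
  · intro a y x
    refine (BoundedFormula.realize_restrictFreeVar (f := r)
      (Sum.elim (Sum.elim a y) fun _ => x) ?_).symm
    rintro ⟨(i | i) | i, h⟩ <;> simp [r]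

/-- The axiom uses a single tuple of parameters for both formulas, so `a` and the parameters of `S`
are concatenated. -/
theorem ModelsLovelyTheory.exists_forall_not_realize (h : ModelsLovelyTheory L Q) {A S : Set M}
    (hS : A.Definable₁ L S) (hinf : S.Infinite) {n m k : ℕ} {a : Fin n → M}
    {ψ : L.Formula ((Fin n ⊕ Fin m) ⊕ Unit)}
    (hψ : ∀ y : Fin m → M,
      {x : M | ψ.Realize (Sum.elim (Sum.elim a y) fun _ => x)}.encard < (k : ℕ∞)) :
    ∃ s ∈ S, ∀ y : Fin m → M, (∀ i, y i ∈ Q) →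
      ¬ ψ.Realize (Sum.elim (Sum.elim a y) fun _ => s) := by
  obtain ⟨n', φ, x, -, rfl⟩ := exists_formula_fin hS
  have hφ : ∀ c : M, (φ.relabel (Sum.map (Fin.natAdd n) id)).Realize
      (Sum.elim (Fin.append a x) fun _ : Unit => c) ↔ φ.Realize (Sum.elim x fun _ => c) := by
    intro c
    rw [Formula.realize_relabel]
    have : Sum.elim (Fin.append a x) (fun _ : Unit => c) ∘ Sum.map (Fin.natAdd n) id =
        Sum.elim x fun _ => c := by
      ext (i | i) <;> simp
    rw [this]
  have hψ' : ∀ (y : Fin m → M) (c : M),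
      (ψ.relabel (Sum.map (Sum.map (Fin.castAdd n') id) id)).Realize
        (Sum.elim (Sum.elim (Fin.append a x) y) fun _ : Unit => c) ↔
      ψ.Realize (Sum.elim (Sum.elim a y) fun _ => c) := by
    intro y c
    rw [Formula.realize_relabel]
    have : Sum.elim (Sum.elim (Fin.append a x) y) (fun _ : Unit => c) ∘
        Sum.map (Sum.map (Fin.castAdd n') id) id = Sum.elim (Sum.elim a y) fun _ => c := by
      ext ((i | i) | i) <;> simp
    rw [this]
  have := h.extension (n + n') m k (φ.relabel (Sum.map (Fin.natAdd n) id))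
    (ψ.relabel (Sum.map (Sum.map (Fin.castAdd n') id) id)) (Fin.append a x)
  simp only [hφ, hψ'] at this
  exact this hψ hinf

end LovelyTheory

/-! ### Realizing nonalgebraic types inside and outside the predicate. -/

section Expansion

variable {L : FirstOrder.Language.{u, v}} {M : Type w} [L.Structure M] [predLang.Structure M]
  {Q : Set M}

theorem definable₁_pred (hQ : ∀ x, x ∈ Q ↔ Structure.RelMap (L := predLang) PredSymb.P ![x])
    (A : Set M) : A.Definable₁ (pairLang L) Q := by
  rw [definable₁_iff_unit, Set.definable_iff_exists_formula_sum]
  refine ⟨Relations.formula (L := pairLang L) (Sum.inr PredSymb.P)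
    ![Term.var (Sum.inr ())], ?_⟩
  ext x
  rw [Set.mem_ofPred_eq, hQ]
  refine Iff.of_eq (congrArg (Structure.RelMap (L := predLang) (PredSymb.P : predLang.Relations 1))
    (funext fun i => ?_))
  rw [Subsingleton.elim i 0]
  rfl

/-- For `ψ` with bounded fibres, sets of this form cut out the complement of `acl (A ∪ Q)`. They use
the predicate only as a quantifier range, so no parameters from the large set `Q` are needed. -/
theorem definable₁_forall_not_realize
    (hQ : ∀ x, x ∈ Q ↔ Structure.RelMap (L := predLang) PredSymb.P ![x])
    {n m : ℕ} (a : Fin n → M) (ψ : L.Formula ((Fin n ⊕ Fin m) ⊕ Unit)) :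
    (Set.range a).Definable₁ (pairLang L)
      {s | ∀ y : Fin m → M, (∀ i, y i ∈ Q) →
        ¬ ψ.Realize (Sum.elim (Sum.elim a y) fun _ => s)} := by
  rw [definable₁_iff_unit]
  have hψ : (Set.range a).Definable (pairLang L) {z : Unit ⊕ Fin m → M |
        ψ.Realize (Sum.elim (Sum.elim a (z ∘ Sum.inr)) fun _ => z (Sum.inl ()))} := by
    have : (Set.range a).Definable L {z : Unit ⊕ Fin m → M |
        ψ.Realize (Sum.elim (Sum.elim a (z ∘ Sum.inr)) fun _ => z (Sum.inl ()))} := by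
      rw [definable_range_iff]
      refine ⟨ψ.relabel (Sum.elim (Sum.elim Sum.inl fun i => Sum.inr (Sum.inr i))
        fun _ => Sum.inr (Sum.inl ())), ?_⟩
      ext z
      simp only [Set.mem_ofPred_eq, Formula.realize_relabel]
      rw [iff_eq_eq]
      congr 1
      ext ((i | i) | i) <;> rfl
    exact this.map_expansion LHom.sumInl
  have hQ' : (Set.range a).Definable (pairLang L)
      {z : Unit ⊕ Fin m → M | ∀ i, z (Sum.inr i) ∈ Q} := by
    have hi : ∀ i : Fin m, (Set.range a).Definable (pairLang L)
        {z : Unit ⊕ Fin m → M | z (Sum.inr i) ∈ Q} := fun i =>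
      Set.Definable.preimage_comp (fun _ : Fin 1 => (Sum.inr i : Unit ⊕ Fin m))
        (definable₁_pred hQ (Set.range a))
    have := Set.definable_iInter_of_finite hi
    convert this using 1
    ext z
    simp
  have := (hQ'.himp hψ.compl).forall_of_finite
  convert this using 1
  ext z
  simp [himp_eq, imp_iff_or_not]

/-- In a saturated lovely pair, a nonalgebraic type over a small set is realized in the
predicate. -/
theorem exists_mem_forall_mem
    (hQ : ∀ x, x ∈ Q ↔ Structure.RelMap (L := predLang) PredSymb.P ![x])
    (h : ModelsLovelyTheory L Q) (hsat : IsSaturated (pairLang L) M) {A : Set M} (hA : #A < #M)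
    {ι : Type*} [Nonempty ι] {S : ι → Set M} (hdir : Directed (· ⊇ ·) S)
    (hS : ∀ i, A.Definable₁ L (S i)) (hinf : ∀ i, (S i).Infinite) : ∃ p ∈ Q, ∀ i, p ∈ S i := by
  obtain ⟨p, hp⟩ := hsat.exists_forall_mem hA (S := fun i => S i ∩ Q)
    (fun i j => (hdir i j).imp fun k hk =>
      ⟨Set.inter_subset_inter_left _ hk.1, Set.inter_subset_inter_left _ hk.2⟩)
    (fun i => ((hS i).map_expansion LHom.sumInl).inter (definable₁_pred hQ A))
    (fun i => (h.exists_mem_of_infinite (hS i) (hinf i)).imp fun p hp => ⟨hp.2, hp.1⟩)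
  exact ⟨p, (hp (Classical.arbitrary ι)).2, fun i => (hp i).1⟩

/-- In a saturated lovely pair, a nonalgebraic type over a small set `A` has a realization that is
not algebraic over `A` and the predicate. -/
theorem exists_notMem_acl
    (hQ : ∀ x, x ∈ Q ↔ Structure.RelMap (L := predLang) PredSymb.P ![x])
    (h : ModelsLovelyTheory L Q) (hsat : IsSaturated (pairLang L) M) {A : Set M} (hA : #A < #M)
    {ι : Type*} [Nonempty ι] {S : ι → Set M} (hdir : Directed (· ⊇ ·) S)
    (hS : ∀ i, A.Definable₁ L (S i)) (hinf : ∀ i, (S i).Infinite) :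
    ∃ c, c ∉ acl L (A ∪ Q) ∧ ∀ i, c ∈ S i := by
  -- A default point of `Q`, assigned to the variables that do not occur in a formula.
  obtain ⟨p₀, hp₀, -⟩ :=
    h.exists_mem_of_infinite (hS (Classical.arbitrary ι)) (hinf (Classical.arbitrary ι))
  -- All potential witnesses of algebraicity over `A ∪ Q`. Avoiding one under every assignment of
  -- its `Q`-variables is a condition over `A` alone; disjunctions make these conditions directed.
  let J := {ψ : L.Formula ((A ⊕ Q) ⊕ Unit) // ∃ k : ℕ, ∀ y : A ⊕ Q → M,
    {x : M | ψ.Realize (Sum.elim y fun _ => x)}.encard < (k : ℕ∞)}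
  let Z : J → Set M := fun ψ => {s | ∀ y : Q → M, (∀ i, y i ∈ Q) →
    ¬ ψ.1.Realize (Sum.elim (Sum.elim (↑) y) fun _ => s)}
  have : Nonempty J := ⟨⟨⊥, 1, fun y => by
    have : {x : M | (⊥ : L.Formula ((A ⊕ Q) ⊕ Unit)).Realize (Sum.elim y fun _ => x)} = ∅ :=
      Set.eq_empty_of_forall_notMem fun x hx => hx
    rw [this, Set.encard_empty]
    exact zero_lt_one⟩⟩
  have hZdir : Directed (· ⊇ ·) Z := by
    rintro ⟨ψ, k, hk⟩ ⟨χ, l, hl⟩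
    refine ⟨⟨ψ ⊔ χ, k + l, fun y => ?_⟩, fun s hs y hy hψ => hs y hy (Formula.realize_sup.2 (.inl hψ)),
      fun s hs y hy hψ => hs y hy (Formula.realize_sup.2 (.inr hψ))⟩
    have : {x : M | (ψ ⊔ χ).Realize (Sum.elim y fun _ => x)} =
        {x : M | ψ.Realize (Sum.elim y fun _ => x)} ∪
          {x : M | χ.Realize (Sum.elim y fun _ => x)} := by
      ext x
      exact Formula.realize_sup
    rw [this, Nat.cast_add]
    exact (Set.encard_union_le _ _).trans_lt (WithTop.add_lt_add (hk y) (hl y))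
  have hZ : ∀ ψ : J, ∃ (n m k : ℕ) (a : Fin n → M) (ψ' : L.Formula ((Fin n ⊕ Fin m) ⊕ Unit)),
      Set.range a ⊆ A ∧ (∀ y : Fin m → M,
        {x : M | ψ'.Realize (Sum.elim (Sum.elim a y) fun _ => x)}.encard < (k : ℕ∞)) ∧
      Z ψ = {s | ∀ y : Fin m → M, (∀ i, y i ∈ Q) →
        ¬ ψ'.Realize (Sum.elim (Sum.elim a y) fun _ => s)} := by
    rintro ⟨ψ, k, hk⟩
    obtain ⟨n, m, f, g, ψ', hg, hψ'⟩ := exists_formula_fin_fin (M := M) ψ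
    have hext : ∀ y : Fin m → M, Function.extend g y (fun _ => p₀) ∘ g = y := fun y =>
      funext fun i => hg.extend_apply _ _ _
    refine ⟨n, m, k, (↑) ∘ f, ψ', ?_, fun y => ?_, ?_⟩
    · rintro _ ⟨i, rfl⟩
      exact (f i).2
    · have := hk (Sum.elim (↑) (Function.extend g y fun _ => p₀))
      simpa only [hψ', hext] using this
    · ext s
      constructor
      · intro hs y hy hψ
        refine hs (Function.extend g y fun _ => p₀) (fun i => ?_) ?_
        · by_cases hi : ∃ j, g j = i
          · obtain ⟨j, rfl⟩ := hi
            rw [hg.extend_apply]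
            exact hy j
          · rwa [Function.extend_apply' _ _ _ hi]
        · rw [hψ', hext]
          exact hψ
      · intro hs y hy hψ
        exact hs (y ∘ g) (fun i => hy _) ((hψ' _ _ _).1 hψ)
  obtain ⟨c, hc⟩ : ∃ c, ∀ i : ι × J, c ∈ S i.1 ∩ Z i.2 := by
    refine hsat.exists_forall_mem hA ?_ ?_ ?_
    · rintro ⟨i, ψ⟩ ⟨j, χ⟩
      obtain ⟨k, hik, hjk⟩ := hdir i j
      obtain ⟨θ, hψ, hχ⟩ := hZdir ψ χ
      exact ⟨(k, θ), Set.inter_subset_inter hik hψ, Set.inter_subset_inter hjk hχ⟩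
    · rintro ⟨i, ψ⟩
      obtain ⟨n, m, k, a, ψ', ha, -, hZψ⟩ := hZ ψ
      have := (definable₁_forall_not_realize hQ a ψ').mono ha
      rw [← hZψ] at this
      exact ((hS i).map_expansion LHom.sumInl).inter this
    · rintro ⟨i, ψ⟩
      obtain ⟨n, m, k, a, ψ', ha, hk, hZψ⟩ := hZ ψ
      obtain ⟨s, hs, hs'⟩ := h.exists_forall_not_realize (hS i) (hinf i) hk
      exact ⟨s, hs, hZψ ▸ hs'⟩
  refine ⟨c, fun hcA => ?_, fun i => (hc (i, Classical.arbitrary J)).1⟩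
  have hr : A ∪ Q = Set.range (Sum.elim ((↑) : A → M) ((↑) : Q → M)) := by
    rw [Set.Sum.elim_range, Subtype.range_coe, Subtype.range_coe]
  rw [hr, mem_acl_range_iff_uniform] at hcA
  obtain ⟨ψ, k, hk, hψ⟩ := hcA
  exact (hc (Classical.arbitrary ι, ⟨ψ, k, hk⟩)).2 (↑) (fun i => i.2) hψ

end Expansion

/-! ### Exchange, bases and closed sets of prescribed codimension. -/

section Pregeometry

variable (L : FirstOrder.Language.{u, v}) (M : Type w) [L.Structure M]

/-- Algebraic closure in `M` has the exchange property. -/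
def HasExchange : Prop :=
  ∀ ⦃A : Set M⦄ ⦃b c : M⦄, b ∈ acl L (insert c A) → b ∉ acl L A → c ∈ acl L (insert b A)

variable {L M}

theorem infinite_of_notMem_acl {A S : Set M} (hS : A.Definable₁ L S) {c : M} (hc : c ∈ S)
    (hcA : c ∉ acl L A) : S.Infinite :=
  fun hfin => hcA ⟨S, hfin, hS, hc⟩

/-- The structure underlying a saturated lovely pair has the exchange property: otherwise an
infinite definable set would be contained in the algebraic closure of the predicate and finitely
many parameters. -/
theorem hasExchange_of_isSaturated [predLang.Structure M] {Q : Set M}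
    (hQ : ∀ x, x ∈ Q ↔ Structure.RelMap (L := predLang) PredSymb.P ![x])
    (h : ModelsLovelyTheory L Q) (hsat : IsSaturated (pairLang L) M) (hM : ℵ₀ < #M) :
    HasExchange L M := by
  classical
  intro A b c hb hbA
  obtain ⟨F, hF, hb⟩ := exists_finset_mem_acl hb
  let A₀ : Set M := (F : Set M) \ {c}
  have hA₀ : A₀ ⊆ A := fun x hx => (hF hx.1).resolve_left hx.2
  have hA₀fin : A₀.Finite := F.finite_toSet.sdiff
  replace hb : b ∈ acl L (insert c A₀) := acl_mono L (by simp [A₀]) hb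
  replace hbA : b ∉ acl L A₀ := fun h' => hbA (acl_mono L hA₀ h')
  by_contra hc
  replace hc : c ∉ acl L (insert b A₀) := fun h' => hc (acl_mono L (Set.insert_subset_insert hA₀) h')
  have hr : ∀ d : M, insert d A₀ = Set.range (Sum.elim ((↑) : A₀ → M) fun _ : Unit => d) := by
    intro d
    rw [Set.Sum.elim_range, Subtype.range_coe, Set.range_const, Set.union_singleton]
  rw [hr, mem_acl_range_iff_uniform] at hb
  obtain ⟨ψ, k, hk, hψ⟩ := hb
  let χ : L.Formula ((A₀ ⊕ Unit) ⊕ Unit) := ψ.relabel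
    (Sum.elim (Sum.elim (fun i => Sum.inl (Sum.inl i)) fun _ => Sum.inr ())
      fun _ => Sum.inl (Sum.inr ()))
  have hχ : ∀ x y : M,
      χ.Realize (Sum.elim (Sum.elim ((↑) : A₀ → M) fun _ => y) fun _ => x) ↔
        ψ.Realize (Sum.elim (Sum.elim ((↑) : A₀ → M) fun _ => x) fun _ => y) := by
    intro x y
    rw [Formula.realize_relabel, iff_eq_eq]
    congr 1
    ext ((i | i) | i) <;> rfl
  choose θ hθ using exists_formula_le_encard (M := M) χ
  -- `Y j` holds the `y` for which at least `j` elements `x` satisfy `ψ(x, y)`. Every `Y j` contains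
  -- `b ∉ acl A₀`, so it is infinite, and some `y ∉ acl (A₀ ∪ Q)` lies in all of them.
  let Y : ℕ → Set M := fun j => {y | (θ j).Realize (Sum.elim ((↑) : A₀ → M) fun _ => y)}
  have hY : ∀ j y, y ∈ Y j ↔ (j : ℕ∞) ≤
      {x | χ.Realize (Sum.elim (Sum.elim ((↑) : A₀ → M) fun _ => y) fun _ => x)}.encard :=
    fun j y => hθ j _
  have hYd : ∀ j, A₀.Definable₁ L (Y j) := by
    intro j
    conv => arg 1; rw [← Subtype.range_coe (s := A₀)]
    exact definable₁_range_iff.2 ⟨θ j, rfl⟩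
  have hbY : ∀ j, b ∈ Y j := by
    intro j
    rw [hY]
    have : {x | χ.Realize
        (Sum.elim (Sum.elim ((↑) : A₀ → M) fun _ => b) fun _ => x)}.Infinite := by
      refine infinite_of_notMem_acl (A := insert b A₀) ?_ ((hχ c b).2 hψ) hc
      rw [hr]
      exact definable₁_range_iff.2 ⟨χ, rfl⟩
    rw [this.encard_eq]
    exact le_top
  have hYdir : Directed (· ⊇ ·) Y := by
    refine directed_of_isDirected_le fun i j hij y hy => ?_
    rw [hY] at hy ⊢
    exact le_trans (by exact_mod_cast hij) hy
  obtain ⟨y, hyA, hy⟩ := exists_notMem_acl hQ h hsat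
    ((Cardinal.lt_aleph0_iff_set_finite.2 hA₀fin).trans hM) hYdir hYd
    fun j => infinite_of_notMem_acl (hYd j) (hbY j) hbA
  have hinf : {x | χ.Realize
      (Sum.elim (Sum.elim ((↑) : A₀ → M) fun _ => y) fun _ => x)}.Infinite := by
    rw [← Set.encard_eq_top_iff]
    exact ENat.eq_top_iff_forall_ge.2 fun j => (hY j y).1 (hy j)
  -- The infinite fibre over `y` contains a point `p` of `Q`; then `ψ` witnesses that `y` is
  -- algebraic over `A₀` and `p`, a contradiction.
  obtain ⟨p, hp, hpy⟩ := h.exists_mem_of_infinite (definable₁_range_iff.2 ⟨χ, rfl⟩) hinf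
  refine hyA (acl_mono L (A := insert p A₀) ?_ ?_)
  · exact Set.insert_subset (.inr hp) Set.subset_union_left
  · rw [hr, mem_acl_range_iff_uniform]
    exact ⟨ψ, k, hk, (hχ p y).1 hpy⟩

theorem exists_notMem_acl_union [predLang.Structure M] {Q : Set M}
    (hQ : ∀ x, x ∈ Q ↔ Structure.RelMap (L := predLang) PredSymb.P ![x])
    (h : ModelsLovelyTheory L Q) (hsat : IsSaturated (pairLang L) M) (hM : ℵ₀ < #M)
    {A : Set M} (hA : #A < #M) : ∃ c, c ∉ acl L (A ∪ Q) := by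
  have : Infinite M := Cardinal.infinite_iff.2 hM.le
  obtain ⟨c, hc, -⟩ := exists_notMem_acl hQ h hsat hA (ι := Unit) (S := fun _ => Set.univ)
    (fun _ _ => ⟨(), subset_rfl, subset_rfl⟩) (fun _ => Set.definable_univ) fun _ =>
      Set.infinite_univ
  exact ⟨c, hc⟩

/-- `B` is algebraically independent over `Q`. -/
def AclIndep (L : FirstOrder.Language.{u, v}) [L.Structure M] (Q B : Set M) : Prop :=
  ∀ b ∈ B, b ∉ acl L (Q ∪ (B \ {b}))

theorem AclIndep.insert (hex : HasExchange L M) {Q B : Set M} (hB : AclIndep L Q B) {c : M}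
    (hc : c ∉ acl L (Q ∪ B)) : AclIndep L Q (insert c B) := by
  have hcB : c ∉ B := fun h => hc (subset_acl L _ (.inr h))
  rintro b (rfl | hb) hmem
  · rw [Set.insert_sdiff_self_of_notMem hcB] at hmem
    exact hc hmem
  · have hne : c ≠ b := fun h => hcB (h ▸ hb)
    rw [Set.insert_sdiff_of_notMem _ (by simpa using hne), Set.union_insert] at hmem
    have := hex hmem (hB b hb)
    rw [← Set.union_insert, Set.insert_sdiff_singleton, Set.insert_eq_of_mem hb] at this
    exact hc this

/-- Every set has a basis of the whole structure over it. -/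
theorem exists_basis (hex : HasExchange L M) (Q : Set M) :
    ∃ B : Set M, acl L (Q ∪ B) = Set.univ ∧ AclIndep L Q B := by
  classical
  obtain ⟨B, hB⟩ : ∃ B, Maximal (fun B => B ∈ {B | AclIndep L Q B}) B := by
    refine zorn_subset _ fun c hc hchain => ⟨⋃₀ c, ?_, fun s hs => Set.subset_sUnion_of_mem hs⟩
    rcases c.eq_empty_or_nonempty with rfl | hne
    · intro b hb
      simp at hb
    rintro b ⟨s, hs, hbs⟩ hb
    obtain ⟨F, hF, hb⟩ := exists_finset_mem_acl hb
    -- The members of `F` outside `Q` are finitely many, so a single member of the chain contains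
    -- them all.
    have hF' : ((F.filter fun x => x ∉ Q : Finset M) : Set M) ⊆ ⋃₀ c := by
      intro x hx
      rw [Finset.coe_filter] at hx
      exact ((hF hx.1).resolve_left hx.2).1
    obtain ⟨t, ht, hFt⟩ := DirectedOn.exists_mem_subset_of_finite_of_subset_sUnion hne hchain.directedOn
      (Finset.finite_toSet _) hF'
    obtain ⟨r, hr, hsr, htr⟩ := hchain.directedOn s hs t ht
    refine hc hr b (hsr hbs) (acl_mono L ?_ hb)
    intro x hx
    rcases hF hx with hxQ | hx'
    · exact .inl hxQ
    · by_cases hxQ : x ∈ Q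
      · exact .inl hxQ
      · exact .inr ⟨htr (hFt (by simpa using ⟨hx, hxQ⟩)), hx'.2⟩
  refine ⟨B, Set.eq_univ_of_forall fun c => ?_, hB.1⟩
  by_contra hc
  have : insert c B ⊆ B := hB.2 (AclIndep.insert hex hB.1 hc) (Set.subset_insert c B)
  exact hc (subset_acl L _ (.inr (this (Set.mem_insert c B))))

/-- A set over which no small set spans has closed extensions of every infinite small
codimension. -/
theorem exists_isAlgClosedSet_hasCodim (hex : HasExchange L M) {Q : Set M}
    (hQ : ∀ A : Set M, #A < #M → acl L (Q ∪ A) ≠ Set.univ) {κ : Cardinal.{w}} (hκ : κ ≤ #M) :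
    ∃ Q', Q ⊆ Q' ∧ IsAlgClosedSet L Q' ∧ HasCodim L Q' κ := by
  obtain ⟨B, hspan, hind⟩ := exists_basis hex Q
  -- A basis smaller than `M` would be a small spanning set over `Q`.
  have hB : κ ≤ #B := hκ.trans (not_lt.1 fun hlt => hQ B hlt hspan)
  obtain ⟨K, hKB, hK⟩ := Cardinal.le_mk_iff_exists_subset.1 hB
  refine ⟨acl L (Q ∪ (B \ K)), Set.subset_union_left.trans (subset_acl L _),
    isAlgClosedSet_acl L _, K, hK, ?_, ?_⟩
  · refine Set.eq_univ_of_univ_subset (hspan ▸ acl_mono L ?_)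
    rintro x (hx | hx)
    · exact .inl (subset_acl L _ (.inl hx))
    · by_cases hxK : x ∈ K
      · exact .inr hxK
      · exact .inl (subset_acl L _ (.inr ⟨hx, hxK⟩))
  · intro b hb hmem
    refine hind b (hKB hb) (acl_subset_acl (Set.union_subset (acl_mono L ?_) ?_) hmem)
    · exact Set.union_subset_union_right _ fun x hx => ⟨hx.1, fun h => hx.2 (h ▸ hb)⟩
    · exact fun x hx => subset_acl L _ (.inr ⟨hKB hx.1, hx.2⟩)

end Pregeometry

/-! ### Rich sets and positions of the back-and-forth game. -/

section BackAndForth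

variable (L : FirstOrder.Language.{u, v}) {M : Type w} [L.Structure M]

/-- `Q` is an algebraically closed set that satisfies the coheir and extension properties for
directed families of definable sets. -/
structure IsRich (Q : Set M) : Prop where
  closed : IsAlgClosedSet L Q
  exists_mem : ∀ A : Set M, A.Finite → ∀ 𝓕 : Set (Set M), 𝓕.Nonempty → DirectedOn (· ⊇ ·) 𝓕 →
    (∀ S ∈ 𝓕, A.Definable₁ L S) → (∀ S ∈ 𝓕, S.Infinite) → ∃ p ∈ Q, ∀ S ∈ 𝓕, p ∈ S
  exists_notMem : ∀ A : Set M, A.Finite → ∀ 𝓕 : Set (Set M), 𝓕.Nonempty →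
    DirectedOn (· ⊇ ·) 𝓕 → (∀ S ∈ 𝓕, A.Definable₁ L S) → (∀ S ∈ 𝓕, S.Infinite) →
      ∃ c, c ∉ acl L (A ∪ Q) ∧ ∀ S ∈ 𝓕, c ∈ S

/-- The tuples `a` and `b` have the same type. -/
def SameType {α : Type*} (a b : α → M) : Prop :=
  ∀ φ : L.Formula α, φ.Realize a ↔ φ.Realize b

/-- The entries of `a` are algebraic over its entries at `π`, which belong to `Q`, and those at
`β`, which are independent over `Q`. -/
structure IsSpanned (Q : Set M) {α : Type*} (a : α → M) (β π : Set α) : Prop where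
  mem : ∀ i ∈ π, a i ∈ Q
  indep : ∀ i ∈ β, a i ∉ acl L (Q ∪ a '' (β \ {i}))
  span : ∀ i, a i ∈ acl L (a '' (β ∪ π))

variable {L}

/-- The independent generators can be dropped one by one: if an entry in `Q` really depended on `a
j`, exchange would make `a j` algebraic over `Q` and the other generators. The right-hand side
depends only on the type of `a`. -/
theorem IsSpanned.mem_iff (hex : HasExchange L M) {Q : Set M} (hQ : IsAlgClosedSet L Q)
    {α : Type*} [Finite α] {a : α → M} {β π : Set α} (h : IsSpanned L Q a β π) (i : α) :
    a i ∈ Q ↔ a i ∈ acl L (a '' π) := by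
  have hπ : a '' π ⊆ Q := by
    rintro _ ⟨j, hj, rfl⟩
    exact h.mem j hj
  refine ⟨fun hi => ?_, fun hi => hQ.subset (acl_mono L hπ hi)⟩
  have key : ∀ T : Set α, T.Finite → T ⊆ β → a i ∈ acl L (a '' (T ∪ π)) →
      a i ∈ acl L (a '' π) := by
    intro T hT
    induction T, hT using Set.Finite.induction_on with
    | empty => simp
    | @insert j T hj _ ih =>
      intro hTβ hmem
      have hTβ' : T ⊆ β := (Set.subset_insert j T).trans hTβ
      by_cases hiT : a i ∈ acl L (a '' (T ∪ π))
      · exact ih hTβ' hiT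
      · rw [Set.insert_union, Set.image_insert_eq] at hmem
        refine (h.indep j (hTβ (Set.mem_insert j T)) ?_).elim
        refine acl_mono L ?_ (hex hmem hiT)
        rw [Set.image_union]
        refine Set.insert_subset (.inl hi) (Set.union_subset ?_ (hπ.trans Set.subset_union_left))
        exact (Set.image_mono fun x hx =>
          (⟨hTβ' hx, fun hxj => hj (hxj ▸ hx)⟩ : x ∈ β \ {j})).trans Set.subset_union_right
  exact key β β.toFinite subset_rfl (h.span i)

theorem SameType.symm {α : Type*} {a b : α → M} (h : SameType L a b) : SameType L b a :=
  fun φ => (h φ).symm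

/-- The tuple `a` with the element `c` added at the index `none`. -/
def extendTuple {α : Type*} (a : α → M) (c : M) (i : Option α) : M := i.elim c a

theorem extendTuple_image_some {α : Type*} (a : α → M) (c : M) (J : Set α) :
    extendTuple a c '' (some '' J) = a '' J := by
  rw [Set.image_image]
  rfl

theorem extendTuple_image_insert {α : Type*} (a : α → M) (c : M) (J : Set α) :
    extendTuple a c '' (insert none (some '' J)) = insert c (a '' J) := by
  rw [Set.image_insert_eq, extendTuple_image_some]
  rfl

/-- The type of `c` over the tuple `a`, transported to the tuple `b`, as a family of definable
sets. -/
def transportedType (L : FirstOrder.Language.{u, v}) [L.Structure M] {α : Type*} (a b : α → M)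
    (c : M) : Set (Set M) :=
  {S | ∃ φ : L.Formula (α ⊕ Unit), φ.Realize (Sum.elim a fun _ => c) ∧
    S = {x | φ.Realize (Sum.elim b fun _ => x)}}

section TransportedType

variable {α : Type*} {a b : α → M} {c : M}

theorem transportedType_nonempty : (transportedType L a b c).Nonempty :=
  ⟨_, ⊤, Formula.realize_top.2 trivial, rfl⟩

theorem directedOn_transportedType : DirectedOn (· ⊇ ·) (transportedType L a b c) := by
  rintro _ ⟨φ, hφ, rfl⟩ _ ⟨ψ, hψ, rfl⟩
  exact ⟨_, ⟨φ ⊓ ψ, Formula.realize_inf.2 ⟨hφ, hψ⟩, rfl⟩, fun x hx => (Formula.realize_inf.1 hx).1,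
    fun x hx => (Formula.realize_inf.1 hx).2⟩

theorem definable₁_of_mem_transportedType {S : Set M} (hS : S ∈ transportedType L a b c) :
    (Set.range b).Definable₁ L S := by
  obtain ⟨φ, -, rfl⟩ := hS
  exact definable₁_range_iff.2 ⟨φ, rfl⟩

theorem SameType.encard_eq (h : SameType L a b) (φ : L.Formula (α ⊕ Unit)) :
    {x | φ.Realize (Sum.elim a fun _ => x)}.encard =
      {x | φ.Realize (Sum.elim b fun _ => x)}.encard := by
  refine ENat.eq_of_forall_natCast_le_iff fun k => ?_
  obtain ⟨θ, hθ⟩ := exists_formula_le_encard (M := M) φ k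
  rw [← hθ, ← hθ, h]

theorem SameType.infinite_of_mem_transportedType (h : SameType L a b)
    (hc : c ∉ acl L (Set.range a)) {S : Set M} (hS : S ∈ transportedType L a b c) :
    S.Infinite := by
  obtain ⟨φ, hφ, rfl⟩ := hS
  rw [← Set.encard_eq_top_iff, ← h.encard_eq, Set.encard_eq_top_iff]
  exact infinite_of_notMem_acl (definable₁_range_iff.2 ⟨φ, rfl⟩) hφ hc

/-- One implication suffices, since it also applies to negations. -/
theorem sameType_extendTuple {d : M} (h : ∀ S ∈ transportedType L a b c, d ∈ S) :
    SameType L (extendTuple a c) (extendTuple b d) := by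
  have key : ∀ φ : L.Formula (Option α), φ.Realize (extendTuple a c) →
      φ.Realize (extendTuple b d) := by
    intro φ hφ
    let r : Option α → α ⊕ Unit := fun i => i.elim (Sum.inr ()) Sum.inl
    have hr : ∀ (e : α → M) (x : M), Sum.elim e (fun _ => x) ∘ r = extendTuple e x := by
      intro e x
      ext (_ | i) <;> rfl
    have := h _ ⟨φ.relabel r, by rw [Formula.realize_relabel, hr]; exact hφ, rfl⟩
    rw [Set.mem_ofPred_eq, Formula.realize_relabel, hr] at this
    exact this
  refine fun φ => ⟨key φ, fun hφ => ?_⟩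
  by_contra hn
  exact Formula.realize_not.1 (key (∼φ) (Formula.realize_not.2 hn)) hφ

/-- A member of the transported type of least size is finite and nonempty. By directedness and
minimality it lies inside every other member, so any of its points works. -/
theorem SameType.exists_of_mem_acl (h : SameType L a b) (hc : c ∈ acl L (Set.range a)) :
    ∃ d, SameType L (extendTuple a c) (extendTuple b d) := by
  obtain ⟨φ, hfin, hφ⟩ := mem_acl_range_iff.1 hc
  obtain ⟨S, hS, hmin⟩ : ∃ S ∈ transportedType L a b c, ∀ T ∈ transportedType L a b c,
      S.encard ≤ T.encard := by
    obtain ⟨S, hS, hmin⟩ := (wellFounded_lt (α := ℕ∞)).onFun (f := Set.encard) |>.has_min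
      (transportedType L a b c) transportedType_nonempty
    exact ⟨S, hS, fun T hT => not_lt.1 (hmin T hT)⟩
  have hSfin : S.Finite := by
    rw [← Set.encard_lt_top_iff] at hfin ⊢
    exact (hmin _ ⟨φ, hφ, rfl⟩).trans_lt (h.encard_eq φ ▸ hfin)
  have hSne : S.Nonempty := by
    obtain ⟨ψ, hψ, rfl⟩ := hS
    rw [← Set.encard_ne_zero, ← h.encard_eq, Set.encard_ne_zero]
    exact ⟨c, hψ⟩
  obtain ⟨d, hd⟩ := hSne
  refine ⟨d, sameType_extendTuple fun T hT => ?_⟩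
  obtain ⟨U, hU, hUS, hUT⟩ := directedOn_transportedType S hS T hT
  have := (hSfin.subset hUS).eq_of_subset_of_encard_le hUS (hmin U hU)
  exact hUT (this ▸ hd)

end TransportedType

/-- A position of the back-and-forth game between `(M, Q)` and `(M, Q')`. -/
structure IsPosition (L : FirstOrder.Language.{u, v}) [L.Structure M] (Q Q' : Set M) {α : Type*}
    (a a' : α → M) (β π : Set α) : Prop where
  sameType : SameType L a a'
  left : IsSpanned L Q a β π
  right : IsSpanned L Q' a' β π

section Position

variable {Q Q' : Set M} {α : Type*} {a a' : α → M} {β π : Set α}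

theorem IsPosition.symm (h : IsPosition L Q Q' a a' β π) : IsPosition L Q' Q a' a β π :=
  ⟨h.sameType.symm, h.right, h.left⟩

theorem IsPosition.mem_iff (hex : HasExchange L M) (hQ : IsAlgClosedSet L Q)
    (hQ' : IsAlgClosedSet L Q') [Finite α] (h : IsPosition L Q Q' a a' β π) (i : α) :
    a i ∈ Q ↔ a' i ∈ Q' := by
  rw [h.left.mem_iff hex hQ, h.right.mem_iff hex hQ']
  exact ⟨mem_acl_image_of_realize_iff h.sameType,
    mem_acl_image_of_realize_iff h.sameType.symm⟩

theorem IsSpanned.range_subset (h : IsSpanned L Q a β π) : Set.range a ⊆ acl L (a '' (β ∪ π)) := by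
  rintro _ ⟨i, rfl⟩
  exact h.span i

theorem IsSpanned.extendTuple_of_mem_acl (h : IsSpanned L Q a β π) {c : M}
    (hc : c ∈ acl L (Set.range a)) :
    IsSpanned L Q (extendTuple a c) (some '' β) (some '' π) where
  mem := by
    rintro _ ⟨i, hi, rfl⟩
    exact h.mem i hi
  indep := by
    rintro _ ⟨i, hi, rfl⟩
    rw [← Set.image_singleton, ← Set.image_sdiff (Option.some_injective α),
      extendTuple_image_some]
    exact h.indep i hi
  span := by
    rw [← Set.image_union, extendTuple_image_some]
    rintro (_ | i)
    · exact acl_subset_acl h.range_subset hc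
    · exact h.span i

theorem IsSpanned.extendTuple_of_mem (h : IsSpanned L Q a β π) {c : M} (hc : c ∈ Q) :
    IsSpanned L Q (extendTuple a c) (some '' β) (insert none (some '' π)) where
  mem := by
    rintro _ (rfl | ⟨i, hi, rfl⟩)
    · exact hc
    · exact h.mem i hi
  indep := by
    rintro _ ⟨i, hi, rfl⟩
    rw [← Set.image_singleton, ← Set.image_sdiff (Option.some_injective α),
      extendTuple_image_some]
    exact h.indep i hi
  span := by
    rw [Set.union_insert, ← Set.image_union, extendTuple_image_insert]
    rintro (_ | i)
    · exact subset_acl L _ (Set.mem_insert _ _)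
    · exact acl_mono L (Set.subset_insert _ _) (h.span i)

theorem IsSpanned.extendTuple_of_notMem_acl (hex : HasExchange L M) (h : IsSpanned L Q a β π)
    {c : M} (hc : c ∉ acl L (Set.range a ∪ Q)) :
    IsSpanned L Q (extendTuple a c) (insert none (some '' β)) (some '' π) where
  mem := by
    rintro _ ⟨i, hi, rfl⟩
    exact h.mem i hi
  indep := by
    have hc' : ∀ J : Set α, c ∉ acl L (Q ∪ a '' J) := fun J hJ => by
      refine hc (acl_mono L (Set.union_subset Set.subset_union_right ?_) hJ)
      exact (Set.image_subset_range a J).trans Set.subset_union_left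
    rintro _ (rfl | ⟨i, hi, rfl⟩)
    · rw [Set.insert_sdiff_self_of_notMem (by simp), extendTuple_image_some]
      exact hc' β
    · rw [Set.insert_sdiff_of_notMem _ (by simp), ← Set.image_singleton,
        ← Set.image_sdiff (Option.some_injective α), extendTuple_image_insert, Set.union_insert]
      intro hmem
      have := hex hmem (h.indep i hi)
      rw [← Set.union_insert] at this
      change c ∈ acl L (Q ∪ insert (a i) _) at this
      rw [← Set.image_insert_eq] at this
      exact hc' _ this
  span := by
    rw [Set.insert_union, ← Set.image_union, extendTuple_image_insert]
    rintro (_ | i)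
    · exact subset_acl L _ (Set.mem_insert _ _)
    · exact acl_mono L (Set.subset_insert _ _) (h.span i)

theorem SameType.mem_acl_range {c c' : M}
    (hc : SameType L (extendTuple a c) (extendTuple a' c')) (hmem : c ∈ acl L (Set.range a)) :
    c' ∈ acl L (Set.range a') := by
  rw [← Set.image_univ, ← extendTuple_image_some a c] at hmem
  have := mem_acl_image_of_realize_iff (i := none) hc hmem
  rwa [extendTuple_image_some, Set.image_univ] at this

end Position

/-- The tuples `v` and `v'` are parts of a position of the back-and-forth game. -/
def IsPartOfPosition (L : FirstOrder.Language.{u, v}) [L.Structure M] (Q Q' : Set M) {γ : Type*}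
    (v v' : γ → M) : Prop :=
  ∃ (α : Type) (_ : Finite α) (a a' : α → M) (β π : Set α) (f : γ → α),
    IsPosition L Q Q' a a' β π ∧ v = a ∘ f ∧ v' = a' ∘ f

end BackAndForth

/-! ### Elementary equivalence of rich pairs by back-and-forth. -/

section ElementaryEquivalence

variable {L : FirstOrder.Language.{u, v}} {M : Type w} [L.Structure M] {Q Q' : Set M}

section

variable {α : Type*} {a a' : α → M} {β π : Set α}

theorem IsPosition.exists_of_mem_acl (h : IsPosition L Q Q' a a' β π) {c : M}
    (hc : c ∈ acl L (Set.range a)) :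
    ∃ c' β' π', IsPosition L Q Q' (extendTuple a c) (extendTuple a' c') β' π' := by
  obtain ⟨c', hc'⟩ := h.sameType.exists_of_mem_acl hc
  exact ⟨c', _, _, hc', h.left.extendTuple_of_mem_acl hc,
    h.right.extendTuple_of_mem_acl (hc'.mem_acl_range hc)⟩

theorem IsPosition.exists_of_mem (hQ' : IsRich L Q') [Finite α]
    (h : IsPosition L Q Q' a a' β π) {c : M} (hc : c ∈ Q) :
    ∃ c' β' π', IsPosition L Q Q' (extendTuple a c) (extendTuple a' c') β' π' := by
  by_cases hca : c ∈ acl L (Set.range a)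
  · exact h.exists_of_mem_acl hca
  · obtain ⟨c', hc', hmem⟩ := hQ'.exists_mem (Set.range a') (Set.finite_range a')
      (transportedType L a a' c) transportedType_nonempty directedOn_transportedType
      (fun S hS => definable₁_of_mem_transportedType hS)
      fun S hS => h.sameType.infinite_of_mem_transportedType hca hS
    exact ⟨c', _, _, sameType_extendTuple hmem, h.left.extendTuple_of_mem hc,
      h.right.extendTuple_of_mem hc'⟩

theorem IsPosition.exists_of_notMem_acl (hex : HasExchange L M) (hQ' : IsRich L Q') [Finite α]
    (h : IsPosition L Q Q' a a' β π) {c : M} (hc : c ∉ acl L (Set.range a ∪ Q)) :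
    ∃ c' β' π', IsPosition L Q Q' (extendTuple a c) (extendTuple a' c') β' π' := by
  have hca : c ∉ acl L (Set.range a) := fun h' => hc (acl_mono L Set.subset_union_left h')
  obtain ⟨c', hc', hmem⟩ := hQ'.exists_notMem (Set.range a') (Set.finite_range a')
    (transportedType L a a' c) transportedType_nonempty directedOn_transportedType
    (fun S hS => definable₁_of_mem_transportedType hS)
    fun S hS => h.sameType.infinite_of_mem_transportedType hca hS
  exact ⟨c', _, _, sameType_extendTuple hmem, h.left.extendTuple_of_notMem_acl hex hc,
    h.right.extendTuple_of_notMem_acl hex hc'⟩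

end

theorem IsPosition.exists_subset_acl (hQ' : IsRich L Q') {F : Set M} (hF : F.Finite)
    (hFQ : F ⊆ Q) {α : Type} [Finite α] {a a' : α → M} {β π : Set α}
    (h : IsPosition L Q Q' a a' β π) :
    ∃ (α₁ : Type) (_ : Finite α₁) (b b' : α₁ → M) (β₁ π₁ : Set α₁) (g : α → α₁),
      IsPosition L Q Q' b b' β₁ π₁ ∧ a = b ∘ g ∧ a' = b' ∘ g ∧ F ⊆ Set.range b := by
  induction F, hF using Set.Finite.induction_on with
  | empty => exact ⟨α, inferInstance, a, a', β, π, id, h, rfl, rfl, Set.empty_subset _⟩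
  | @insert p F _ _ ih =>
    rw [Set.insert_subset_iff] at hFQ
    obtain ⟨α₁, _, b, b', β₁, π₁, g, hpos, rfl, rfl, hFb⟩ := ih hFQ.2
    obtain ⟨p', β₂, π₂, hpos'⟩ := hpos.exists_of_mem hQ' hFQ.1
    refine ⟨Option α₁, inferInstance, _, _, β₂, π₂, some ∘ g, hpos', rfl, rfl, ?_⟩
    refine Set.insert_subset ⟨none, rfl⟩ (hFb.trans ?_)
    rintro _ ⟨i, rfl⟩
    exact ⟨some i, rfl⟩

section

variable {γ : Type*} {v v' : γ → M}

theorem IsPartOfPosition.symm (h : IsPartOfPosition L Q Q' v v') :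
    IsPartOfPosition L Q' Q v' v := by
  obtain ⟨α, hα, a, a', β, π, f, hpos, hv, hv'⟩ := h
  exact ⟨α, hα, a', a, β, π, f, hpos.symm, hv', hv⟩

theorem IsPartOfPosition.comp {δ : Type*} (h : IsPartOfPosition L Q Q' v v') (g : δ → γ) :
    IsPartOfPosition L Q Q' (v ∘ g) (v' ∘ g) := by
  obtain ⟨α, hα, a, a', β, π, f, hpos, rfl, rfl⟩ := h
  exact ⟨α, hα, a, a', β, π, f ∘ g, hpos, rfl, rfl⟩

theorem IsPartOfPosition.sameType (h : IsPartOfPosition L Q Q' v v') : SameType L v v' := by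
  obtain ⟨α, hα, a, a', β, π, f, hpos, rfl, rfl⟩ := h
  intro φ
  rw [← Formula.realize_relabel, ← Formula.realize_relabel]
  exact hpos.sameType _

theorem IsPartOfPosition.mem_iff (hex : HasExchange L M) (hQ : IsRich L Q) (hQ' : IsRich L Q')
    (h : IsPartOfPosition L Q Q' v v') (i : γ) : v i ∈ Q ↔ v' i ∈ Q' := by
  obtain ⟨α, hα, a, a', β, π, f, hpos, rfl, rfl⟩ := h
  exact hpos.mem_iff hex hQ.closed hQ'.closed (f i)

/-- If `c` depends on the tuple and `Q`, the finitely many elements of `Q` involved are added first,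
making `c` algebraic over the tuple. Otherwise `c` becomes a new independent generator. Passing to
parts of positions hides the auxiliary entries. -/
theorem IsPartOfPosition.forth (hex : HasExchange L M) (hQ' : IsRich L Q')
    (h : IsPartOfPosition L Q Q' v v') (c : M) :
    ∃ c', IsPartOfPosition L Q Q' (extendTuple v c) (extendTuple v' c') := by
  classical
  obtain ⟨α, hα, a, a', β, π, f, hpos, rfl, rfl⟩ := h
  suffices H : ∃ (α₁ : Type) (_ : Finite α₁) (b b' : α₁ → M) (β₁ π₁ : Set (Option α₁))
      (g : α → α₁) (c' : M), IsPosition L Q Q' (extendTuple b c) (extendTuple b' c')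
        β₁ π₁ ∧ a = b ∘ g ∧ a' = b' ∘ g by
    obtain ⟨α₁, _, b, b', β₁, π₁, g, c', h₁, rfl, rfl⟩ := H
    refine ⟨c', Option α₁, inferInstance, _, _, β₁, π₁, Option.map (g ∘ f), h₁, ?_, ?_⟩ <;>
    · ext (_ | i) <;> rfl
  by_cases hc : c ∈ acl L (Set.range a ∪ Q)
  · obtain ⟨F, hF, hcF⟩ := exists_finset_mem_acl hc
    obtain ⟨α₁, _, b, b', β₁, π₁, g, hpos', rfl, rfl, hFb⟩ :=
      hpos.exists_subset_acl hQ' (F := F ∩ Q) (F.finite_toSet.inter_of_left Q)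
        Set.inter_subset_right
    obtain ⟨c', β₂, π₂, h₂⟩ := hpos'.exists_of_mem_acl (c := c) (by
      refine acl_mono L (fun x hx => ?_) hcF
      rcases hF hx with hx' | hx'
      · exact Set.range_comp_subset_range _ _ hx'
      · exact hFb ⟨hx, hx'⟩)
    exact ⟨_, inferInstance, _, _, β₂, π₂, g, c', h₂, rfl, rfl⟩
  · obtain ⟨c', β₁, π₁, h₁⟩ := hpos.exists_of_notMem_acl hex hQ' hc
    exact ⟨_, inferInstance, _, _, _, _, id, c', h₁, rfl, rfl⟩

end

variable (L) in
theorem exists_term_realize_eq {α : Type*} (t : (pairLang L).Term α) :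
    ∃ t' : L.Term α, ∀ (Q : Set M) (v : α → M), t.realize (M := Pair Q) v = t'.realize v := by
  induction t with
  | var i => exact ⟨Term.var i, fun Q v => rfl⟩
  | func f ts ih =>
    choose ts' hts' using ih
    rcases f with f | f
    · refine ⟨Term.func f ts', fun Q v => ?_⟩
      exact congrArg (Structure.funMap (L := L) f : (_ → M) → M) (funext fun i => hts' i Q v)
    · exact f.elim

theorem IsPartOfPosition.realize_eq {γ : Type*} {v v' : γ → M} {c c' : M}
    (h : IsPartOfPosition L Q Q' (extendTuple v c) (extendTuple v' c')) {t : L.Term γ}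
    (hc : c = t.realize v) : c' = t.realize v' := by
  have key : ∀ (e : γ → M) (x : M),
      (Term.equal (Term.var none) (t.relabel some) : L.Formula (Option γ)).Realize
        (extendTuple e x) ↔ x = t.realize e := by
    intro e x
    rw [Formula.realize_equal, Term.realize_relabel]
    rfl
  exact (key _ _).1 ((h.sameType _).1 ((key _ _).2 hc))

theorem IsPartOfPosition.realize_iff (hex : HasExchange L M) (hQ : IsRich L Q)
    (hQ' : IsRich L Q') {n : ℕ} (φ : (pairLang L).BoundedFormula Empty n) {x x' : Fin n → M}
    (h : IsPartOfPosition L Q Q' x x') :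
    φ.Realize (M := Pair Q) Empty.elim x ↔ φ.Realize (M := Pair Q') Empty.elim x' := by
  have hsum : ∀ {m : ℕ} {x x' : Fin m → M}, IsPartOfPosition L Q Q' x x' →
      IsPartOfPosition L Q Q' (Sum.elim Empty.elim x : Empty ⊕ Fin m → M)
        (Sum.elim Empty.elim x') := by
    intro m x x' h
    convert h.comp (Sum.elim Empty.elim id : Empty ⊕ Fin m → Fin m) using 1 <;>
    · ext (i | i)
      · exact i.elim
      · rfl
  have hsnoc : ∀ {m : ℕ} {x x' : Fin m → M} {c c' : M},
      IsPartOfPosition L Q Q' (extendTuple x c) (extendTuple x' c') →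
      IsPartOfPosition L Q Q' (Fin.snoc x c : Fin (m + 1) → M) (Fin.snoc x' c') := by
    intro m x x' c c' h
    convert h.comp (Fin.lastCases none some) using 1 <;>
    · ext i
      refine Fin.lastCases ?_ (fun i => ?_) i <;> simp [extendTuple]
  induction φ with
  | falsum => rfl
  | equal t₁ t₂ =>
    obtain ⟨s₁, hs₁⟩ := exists_term_realize_eq (M := M) L t₁
    obtain ⟨s₂, hs₂⟩ := exists_term_realize_eq (M := M) L t₂
    simp only [BoundedFormula.Realize]
    erw [hs₁, hs₂, hs₁, hs₂]
    have := (hsum h).sameType (Term.equal s₁ s₂)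
    rwa [Formula.realize_equal, Formula.realize_equal] at this
  | rel R ts =>
    choose ss hss using fun i => exists_term_realize_eq (M := M) L (ts i)
    have hts : ∀ (Q : Set M) (y : Fin _ → M),
        (fun i => (ts i).realize (M := Pair Q) (Sum.elim Empty.elim y)) =
          fun i => (ss i).realize (Sum.elim Empty.elim y : _ → M) :=
      fun Q y => funext fun i => hss i Q _
    rcases R with R | R
    · have key : ∀ (Q : Set M) (y : Fin _ → M),
          ((BoundedFormula.rel (Sum.inl R) ts : (pairLang L).BoundedFormula Empty _).Realize
            (M := Pair Q) Empty.elim y) ↔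
          (Relations.formula R ss).Realize (Sum.elim Empty.elim y : _ → M) := fun Q y =>
        (Iff.of_eq (congrArg (Structure.RelMap (L := L) R : (_ → M) → Prop) (hts Q y))).trans
          Formula.realize_rel.symm
      rw [key, key]
      exact (hsum h).sameType _
    · cases R
      have key : ∀ (Q : Set M) (y : Fin _ → M),
          ((BoundedFormula.rel (Sum.inr PredSymb.P) ts :
            (pairLang L).BoundedFormula Empty _).Realize (M := Pair Q) Empty.elim y) ↔
          (ss 0).realize (Sum.elim Empty.elim y : _ → M) ∈ Q := fun Q y =>
        Iff.of_eq (congrArg (· ∈ Q) (congrFun (hts Q y) 0))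
      rw [key, key]
      -- The value of the term need not be an entry of the tuple, so it is added; equality of types
      -- forces its partner to be the value of the same term.
      obtain ⟨c', hc'⟩ := (hsum h).forth hex hQ' ((ss 0).realize (Sum.elim Empty.elim x : _ → M))
      rw [← hc'.realize_eq rfl]
      exact hc'.mem_iff hex hQ hQ' none
  | imp φ ψ ih₁ ih₂ => exact imp_congr (ih₁ h) (ih₂ h)
  | all φ ih =>
    constructor
    · intro H c'
      obtain ⟨c, hc⟩ := h.symm.forth hex hQ c'
      exact (ih (hsnoc hc.symm)).1 (H c)
    · intro H c
      obtain ⟨c', hc⟩ := h.forth hex hQ' c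
      exact (ih (hsnoc hc)).2 (H c')

theorem elementarilyEquivalent_of_isRich (hex : HasExchange L M) (hQ : IsRich L Q)
    (hQ' : IsRich L Q') : Pair Q ≅[pairLang L] Pair Q' := by
  rw [elementarilyEquivalent_iff]
  intro φ
  -- The empty tuples have the same type because both pairs expand the same `L`-structure.
  have hpos : IsPartOfPosition L Q Q' (Fin.elim0 : Fin 0 → M) Fin.elim0 := by
    refine ⟨Empty, inferInstance, Empty.elim, Empty.elim, ∅, ∅, Fin.elim0,
      ⟨fun φ => Iff.rfl, ?_, ?_⟩, funext fun i => i.elim0, funext fun i => i.elim0⟩ <;>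
    exact ⟨fun i => i.elim, fun i => i.elim, fun i => i.elim⟩
  have key : ∀ Q : Set M, (Pair Q) ⊨ φ ↔
      BoundedFormula.Realize (M := Pair Q) φ Empty.elim Fin.elim0 := fun Q =>
    Iff.of_eq (congrArg₂ (BoundedFormula.Realize (M := Pair Q) φ) (Subsingleton.elim _ _)
      (Subsingleton.elim _ _))
  rw [key, key]
  exact hpos.realize_iff hex hQ hQ' φ

end ElementaryEquivalence

/-! ### Transfer of addition and the dense order from the reals. -/

section Transfer

variable {L : FirstOrder.Language.{u, v}}

theorem realize_of_completeTheory {N : Type*} [L.Structure N] {M : Type*} [L.Structure M]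
    [M ⊨ L.completeTheory N] {α : Type*} [Finite α] (φ : L.Formula α)
    (h : ∀ v : α → N, φ.Realize v) (v : α → M) : φ.Realize v := by
  let σ : L.Sentence := Formula.iAlls α (φ.relabel (Sum.inr : α → Empty ⊕ α))
  have hσM : M ⊨ σ ↔ ∀ v : α → M, φ.Realize v := by
    rw [Sentence.Realize, Formula.realize_iAlls]
    simp only [Formula.realize_relabel, Sum.elim_comp_inr]
  have hσN : N ⊨ σ ↔ ∀ v : α → N, φ.Realize v := by
    rw [Sentence.Realize, Formula.realize_iAlls]
    simp only [Formula.realize_relabel, Sum.elim_comp_inr]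
  exact hσM.1 (Theory.realize_sentence_of_mem (M := M) (L.completeTheory N)
    (mem_completeTheory.2 (hσN.2 h))) v

theorem comp_vecCons₂ {α β : Type*} (v : α → β) (a b : α) : v ∘ ![a, b] = ![v a, v b] := by
  ext i
  fin_cases i <;> rfl

theorem comp_vecCons₃ {α β : Type*} (v : α → β) (a b c : α) :
    v ∘ ![a, b, c] = ![v a, v b, v c] := by
  ext i
  fin_cases i <;> rfl

/-- The formula `add` defines an operation such that left translations are surjective and right
translations are injective. -/
structure DefinesAddition (add : L.Formula (Fin 3)) (M : Type*) [L.Structure M] : Prop where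
  exists_right : ∀ a c : M, ∃ b, add.Realize ![a, b, c]
  functional : ∀ a b c d : M, add.Realize ![a, b, c] → add.Realize ![a, b, d] → c = d
  right_cancel : ∀ a b c d : M, add.Realize ![a, c, d] → add.Realize ![b, c, d] → a = b

theorem DefinesAddition.transfer {N : Type*} [L.Structure N] {M : Type*} [L.Structure M]
    [M ⊨ L.completeTheory N] {add : L.Formula (Fin 3)} (h : DefinesAddition add N) :
    DefinesAddition add M where
  exists_right a c := by
    let φ : L.Formula (Fin 2) := Formula.iExs Unit
      (add.relabel ![Sum.inl 0, Sum.inr (), Sum.inl 1])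
    have := realize_of_completeTheory (N := N) (M := M) φ (fun v => by
      obtain ⟨b, hb⟩ := h.exists_right (v 0) (v 1)
      rw [Formula.realize_iExs]
      refine ⟨fun _ => b, ?_⟩
      rw [Formula.realize_relabel, comp_vecCons₃]
      exact hb) ![a, c]
    rw [Formula.realize_iExs] at this
    obtain ⟨b, hb⟩ := this
    rw [Formula.realize_relabel, comp_vecCons₃] at hb
    exact ⟨b (), hb⟩
  functional a b c d := by
    let φ : L.Formula (Fin 4) := (add.relabel ![0, 1, 2]).imp ((add.relabel ![0, 1, 3]).imp
      (Term.equal (Term.var 2) (Term.var 3)))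
    have := realize_of_completeTheory (N := N) (M := M) φ (fun v => by
      simp only [φ, Formula.realize_imp, Formula.realize_relabel, comp_vecCons₃,
        Formula.realize_equal, Term.realize_var]
      exact h.functional _ _ _ _) ![a, b, c, d]
    simp only [φ, Formula.realize_imp, Formula.realize_relabel, comp_vecCons₃,
        Formula.realize_equal, Term.realize_var] at this
    exact this
  right_cancel a b c d := by
    let φ : L.Formula (Fin 4) := (add.relabel ![0, 2, 3]).imp ((add.relabel ![1, 2, 3]).imp
      (Term.equal (Term.var 0) (Term.var 1)))
    have := realize_of_completeTheory (N := N) (M := M) φ (fun v => by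
      simp only [φ, Formula.realize_imp, Formula.realize_relabel, comp_vecCons₃,
        Formula.realize_equal, Term.realize_var]
      exact h.right_cancel _ _ _ _) ![a, b, c, d]
    simp only [φ, Formula.realize_imp, Formula.realize_relabel, comp_vecCons₃,
        Formula.realize_equal, Term.realize_var] at this
    exact this

/-- The formula `lt` defines a dense strict order. -/
structure DefinesDenseOrder (lt : L.Formula (Fin 2)) (M : Type*) [L.Structure M] : Prop where
  irrefl : ∀ a : M, ¬ lt.Realize ![a, a]
  trans : ∀ a b c : M, lt.Realize ![a, b] → lt.Realize ![b, c] → lt.Realize ![a, c]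
  dense : ∀ a b : M, lt.Realize ![a, b] → ∃ c, lt.Realize ![a, c] ∧ lt.Realize ![c, b]

theorem DefinesDenseOrder.transfer {N : Type*} [L.Structure N] {M : Type*} [L.Structure M]
    [M ⊨ L.completeTheory N] {lt : L.Formula (Fin 2)} (h : DefinesDenseOrder lt N) :
    DefinesDenseOrder lt M where
  irrefl a := by
    let φ : L.Formula (Fin 1) := ∼(lt.relabel ![0, 0])
    have := realize_of_completeTheory (N := N) (M := M) φ (fun v => by
      simp only [φ, Formula.realize_not, Formula.realize_relabel, comp_vecCons₂]
      exact h.irrefl _) ![a]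
    simp only [φ, Formula.realize_not, Formula.realize_relabel, comp_vecCons₂] at this
    exact this
  trans a b c := by
    let φ : L.Formula (Fin 3) := (lt.relabel ![0, 1]).imp ((lt.relabel ![1, 2]).imp
      (lt.relabel ![0, 2]))
    have := realize_of_completeTheory (N := N) (M := M) φ (fun v => by
      simp only [φ, Formula.realize_imp, Formula.realize_relabel, comp_vecCons₂]
      exact h.trans _ _ _) ![a, b, c]
    simp only [φ, Formula.realize_imp, Formula.realize_relabel, comp_vecCons₂] at this
    exact this
  dense a b := by
    let φ : L.Formula (Fin 2) := lt.imp (Formula.iExs Unit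
      ((lt.relabel ![Sum.inl 0, Sum.inr ()]) ⊓ (lt.relabel ![Sum.inr (), Sum.inl 1])))
    have := realize_of_completeTheory (N := N) (M := M) φ (fun v => by
      simp only [φ, Formula.realize_imp, Formula.realize_iExs, Formula.realize_inf,
        Formula.realize_relabel, comp_vecCons₂]
      intro hv
      have hv' : v = ![v 0, v 1] := by
        ext i
        fin_cases i <;> rfl
      rw [hv'] at hv
      obtain ⟨c, hc⟩ := h.dense _ _ hv
      exact ⟨fun _ => c, hc⟩) ![a, b]
    simp only [φ, Formula.realize_imp, Formula.realize_iExs, Formula.realize_inf,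
        Formula.realize_relabel, comp_vecCons₂] at this
    intro hab
    obtain ⟨c, hc⟩ := this hab
    exact ⟨c (), hc⟩

theorem DefinesDenseOrder.infinite_Ioo {M : Type*} [L.Structure M] {lt : L.Formula (Fin 2)}
    (h : DefinesDenseOrder lt M) {a b : M} (hab : lt.Realize ![a, b]) :
    {c | lt.Realize ![a, c] ∧ lt.Realize ![c, b]}.Infinite := by
  let _ : Preorder M :=
    { le := fun a b => a = b ∨ lt.Realize ![a, b]
      lt := fun a b => lt.Realize ![a, b]
      le_refl := fun a => .inl rfl
      le_trans := by
        rintro a b c (rfl | hab) (rfl | hbc)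
        · exact .inl rfl
        · exact .inr hbc
        · exact .inr hab
        · exact .inr (h.trans _ _ _ hab hbc)
      lt_iff_le_not_ge := by
        intro a b
        constructor
        · intro hab
          refine ⟨.inr hab, ?_⟩
          rintro (rfl | hba)
          · exact h.irrefl _ hab
          · exact h.irrefl _ (h.trans _ _ _ hab hba)
        · rintro ⟨rfl | hab, hn⟩
          · exact (hn (.inl rfl)).elim
          · exact hab }
  have : DenselyOrdered M := ⟨h.dense⟩
  exact Set.Ioo_infinite (show a < b from hab)

end Transfer

/-! ### Richness of closed sets of infinite codimension. -/

section Extensions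

variable {L : FirstOrder.Language.{u, v}} {M : Type w} [L.Structure M]

theorem definable₁_translate (add : L.Formula (Fin 3)) {A S : Set M} (hS : A.Definable₁ L S)
    (b : M) : (insert b A).Definable₁ L {x | ∃ s ∈ S, add.Realize ![b, x, s]} := by
  have hr : insert b A = Set.range (Sum.elim ((↑) : A → M) fun _ : Unit => b) := by
    rw [Set.Sum.elim_range, Subtype.range_coe, Set.range_const, Set.union_singleton]
  rw [hr]
  rw [← Subtype.range_coe (s := A), definable₁_range_iff] at hS
  obtain ⟨φ, rfl⟩ := hS
  rw [definable₁_range_iff]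
  refine ⟨Formula.iExs Unit
    ((φ.relabel (Sum.elim (fun i => Sum.inl (Sum.inl (Sum.inl i))) Sum.inr)) ⊓
      add.relabel ![Sum.inl (Sum.inl (Sum.inr ())), Sum.inl (Sum.inr ()), Sum.inr ()]), ?_⟩
  ext x
  rw [Set.mem_ofPred_eq, Set.mem_ofPred_eq, Formula.realize_iExs]
  have hφ : ∀ s : Unit → M, Sum.elim (Sum.elim (Sum.elim ((↑) : A → M) fun _ : Unit => b)
      fun _ : Unit => x) s ∘ (Sum.elim (fun i => Sum.inl (Sum.inl (Sum.inl i))) Sum.inr) =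
      Sum.elim (↑) fun _ => s () := by
    intro s
    ext (i | i) <;> rfl
  simp only [Formula.realize_inf, Formula.realize_relabel, comp_vecCons₃, hφ]
  exact ⟨fun ⟨s, hs⟩ => ⟨fun _ => s, hs⟩, fun ⟨s, hs⟩ => ⟨s (), hs⟩⟩

/-- By right cancellation `b` is the only solution of `x + p = s`. -/
theorem DefinesAddition.mem_acl {add : L.Formula (Fin 3)} (h : DefinesAddition add M) {b p s : M}
    (hs : add.Realize ![b, p, s]) {A : Set M} (hpA : p ∈ A) (hsA : s ∈ A) : b ∈ acl L A := by
  refine acl_mono L (A := Set.range ![p, s]) ?_ (mem_acl_range_iff.2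
    ⟨add.relabel ![Sum.inr (), Sum.inl 0, Sum.inl 1], ?_, ?_⟩)
  · rintro _ ⟨i, rfl⟩
    fin_cases i
    · exact hpA
    · exact hsA
  · refine Set.Subsingleton.finite fun x hx y hy => ?_
    rw [Set.mem_ofPred_eq, Formula.realize_relabel, comp_vecCons₃] at hx hy
    exact h.right_cancel x y p s hx hy
  · rw [Formula.realize_relabel, comp_vecCons₃]
    exact hs

/-- A set of infinite codimension spans the structure over no finite set. -/
theorem HasCodim.exists_notMem_acl {Q : Set M} {κ : Cardinal.{w}} (h : HasCodim L Q κ)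
    (hκ : ℵ₀ ≤ κ) {A : Set M} (hA : A.Finite) : ∃ b, b ∉ acl L (A ∪ Q) := by
  classical
  obtain ⟨B, hB, hspan, hind⟩ := h
  have hfin : ∃ B₀ ⊆ B, B₀.Finite ∧ A ⊆ acl L (Q ∪ B₀) := by
    induction A, hA using Set.Finite.induction_on with
    | empty => exact ⟨∅, Set.empty_subset _, Set.finite_empty, Set.empty_subset _⟩
    | @insert a A _ _ ih =>
      obtain ⟨B₀, hB₀, hfin, hA⟩ := ih
      obtain ⟨F, hF, haF⟩ := exists_finset_mem_acl (hspan ▸ Set.mem_univ a : a ∈ acl L (Q ∪ B))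
      refine ⟨B₀ ∪ (F ∩ B), Set.union_subset hB₀ Set.inter_subset_right,
        hfin.union (F.finite_toSet.inter_of_left B), Set.insert_subset ?_ ?_⟩
      · refine acl_mono L (fun x hx => ?_) haF
        rcases hF hx with hx' | hx'
        · exact .inl hx'
        · exact .inr (.inr ⟨hx, hx'⟩)
      · exact hA.trans (acl_mono L (Set.union_subset_union_right _ Set.subset_union_left))
  obtain ⟨B₀, hB₀, hfin, hA⟩ := hfin
  have hBinf : B.Infinite := by
    rw [← Set.infinite_coe_iff, Cardinal.infinite_iff, hB]
    exact hκ
  -- `A` depends on only finitely many basis elements, so any remaining one is independent of `A`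
  -- over `Q`.
  obtain ⟨b, hbB, hbB₀⟩ := hBinf.exists_notMem_finite hfin
  refine ⟨b, fun hb => hind b hbB (acl_subset_acl (Set.union_subset ?_ ?_) hb)⟩
  · exact hA.trans (acl_mono L (Set.union_subset_union_right _ fun x hx =>
      (⟨hB₀ hx, fun h => hbB₀ (h ▸ hx)⟩ : x ∈ B \ {b})))
  · exact Set.subset_union_left.trans (subset_acl L _)

/-- Closed sets of infinite codimension that contain the predicate of a saturated lovely pair are
rich. -/
theorem isRich_of_subset [predLang.Structure M] {P Q : Set M}
    (hP : ∀ x, x ∈ P ↔ Structure.RelMap (L := predLang) PredSymb.P ![x])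
    (h : ModelsLovelyTheory L P) (hsat : IsSaturated (pairLang L) M) (hM : ℵ₀ < #M)
    {add : L.Formula (Fin 3)} (hadd : DefinesAddition add M) (hPQ : P ⊆ Q)
    (hQ : IsAlgClosedSet L Q) (hcodim : ∀ A : Set M, A.Finite → ∃ b, b ∉ acl L (A ∪ Q)) :
    IsRich L Q where
  closed := hQ
  exists_mem A hA 𝓕 hne hdir hd hinf := by
    have := hne.coe_sort
    obtain ⟨p, hp, hp'⟩ := exists_mem_forall_mem hP h hsat
      ((Cardinal.lt_aleph0_iff_set_finite.2 hA).trans hM) (S := fun S : 𝓕 => (S : Set M))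
      hdir.directed_val (fun S => hd S S.2) (fun S => hinf S S.2)
    exact ⟨p, hPQ hp, fun S hS => hp' ⟨S, hS⟩⟩
  exists_notMem A hA 𝓕 hne hdir hd hinf := by
    have := hne.coe_sort
    obtain ⟨b, hb⟩ := hcodim A hA
    -- The type translated by `b` is realized by some `p` in `P`; the desired element is `s = b +
    -- p`, the same `s` for every member of the family since addition is functional.
    obtain ⟨p, hp, hp'⟩ := exists_mem_forall_mem hP h hsat (A := insert b A)
      ((Cardinal.lt_aleph0_iff_set_finite.2 (hA.insert b)).trans hM)
      (S := fun S : 𝓕 => {x | ∃ s ∈ (S : Set M), add.Realize ![b, x, s]})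
      (fun S T => by
        obtain ⟨U, hUS, hUT⟩ := hdir.directed_val S T
        exact ⟨U, fun x ⟨s, hs, hx⟩ => ⟨s, hUS hs, hx⟩, fun x ⟨s, hs, hx⟩ => ⟨s, hUT hs, hx⟩⟩)
      (fun S => definable₁_translate add (hd S S.2) b)
      (fun S => by
        choose f hf using hadd.exists_right b
        refine Set.infinite_of_injOn_mapsTo (f := f) (s := S) (fun s _ t _ hst => ?_)
          (fun s hs => ⟨s, hs, hf s⟩) (hinf S S.2)
        exact hadd.functional b (f s) s t (hf s) (hst ▸ hf t))
    obtain ⟨S₀, hS₀⟩ := hne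
    obtain ⟨s, hs, hbs⟩ := hp' ⟨S₀, hS₀⟩
    refine ⟨s, fun hsA => hb ?_, fun S hS => ?_⟩
    · exact acl_subset_acl subset_rfl (hadd.mem_acl hbs (subset_acl L _ (.inr (hPQ hp))) hsA)
    · obtain ⟨t, ht, hbt⟩ := hp' ⟨S, hS⟩
      rwa [hadd.functional b p s t hbs hbt]

theorem IsRich.isCodense {Q : Set M} (hQ : IsRich L Q) {lt : L.Formula (Fin 2)}
    (hlt : DefinesDenseOrder lt M) : IsCodense lt Q := by
  intro a b hab
  have hd : (Set.range ![a, b]).Definable₁ L {c | lt.Realize ![a, c] ∧ lt.Realize ![c, b]} := by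
    rw [definable₁_range_iff]
    refine ⟨lt.relabel ![Sum.inl 0, Sum.inr ()] ⊓ lt.relabel ![Sum.inr (), Sum.inl 1], ?_⟩
    ext c
    simp only [Set.mem_ofPred_eq, Formula.realize_inf, Formula.realize_relabel, comp_vecCons₂]
    rfl
  obtain ⟨c, hc, hmem⟩ := hQ.exists_notMem _ (Set.finite_range ![a, b]) {_}
    (Set.singleton_nonempty _) (directedOn_singleton _) (by rintro _ rfl; exact hd)
    (by rintro _ rfl; exact hlt.infinite_Ioo hab)
  obtain ⟨hac, hcb⟩ := hmem _ rfl
  exact ⟨c, hac, hcb, fun hcQ => hc (subset_acl L _ (.inr hcQ))⟩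

/-- Elementarity is the Tarski–Vaught test: a finite `Q`-definable set lies in `Q` by closedness,
and an infinite one meets `Q` by the coheir property. -/
theorem IsRich.isLovelyPair {Q : Set M} (hQ : IsRich L Q) : IsLovelyPair L Q where
  elementary := by
    have hmeets : L.MeetsDefinable Q := by
      intro D hne hD
      by_cases hfin : D.Finite
      · obtain ⟨d, hd⟩ := hne
        exact ⟨d, hd, hQ.closed.subset ⟨D, hfin, hD, hd⟩⟩
      · obtain ⟨F, -, hF⟩ := Set.definable_iff_finitely_definable.1 hD
        obtain ⟨p, hp, hpD⟩ := hQ.exists_mem F F.finite_toSet {D} (Set.singleton_nonempty D)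
          (directedOn_singleton D) (by rintro _ rfl; exact hF) (by rintro _ rfl; exact hfin)
        exact ⟨p, hpD D rfl, hp⟩
    exact ⟨hmeets.toElementarySubstructure, hmeets.closure_eq_self⟩
  coheir A hA q hq := by
    obtain ⟨p, hp, hp'⟩ := hQ.exists_mem A hA (Set.range q.sets) (Set.range_nonempty _)
      (directedOn_range.2 q.directed_sets)
      (by rintro _ ⟨φ, rfl⟩; exact q.definable₁_sets φ) (by rintro _ ⟨φ, rfl⟩; exact hq _ φ.2)
    exact ⟨p, hp, fun φ hφ => hp' _ ⟨⟨φ, hφ⟩, rfl⟩⟩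
  extension A hA q hq := by
    obtain ⟨c, hc, hc'⟩ := hQ.exists_notMem A hA (Set.range q.sets) (Set.range_nonempty _)
      (directedOn_range.2 q.directed_sets)
      (by rintro _ ⟨φ, rfl⟩; exact q.definable₁_sets φ) (by rintro _ ⟨φ, rfl⟩; exact hq _ φ.2)
    exact ⟨c, hc, fun φ hφ => hc' _ ⟨⟨φ, hφ⟩, rfl⟩⟩

end Extensions

/-! ### Codimension as an obstruction to isomorphism. -/

section Isomorphism

variable {L : FirstOrder.Language.{u, v}} {M : Type w} [L.Structure M]

theorem map_mem_acl (g : M ≃[L] M) {A : Set M} {c : M} (hc : c ∈ acl L A) :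
    g c ∈ acl L (g '' A) := by
  rw [← Subtype.range_coe (s := A), mem_acl_range_iff] at hc
  obtain ⟨φ, hfin, hφ⟩ := hc
  have key : ∀ x, φ.Realize (Sum.elim (fun a : A => g a) fun _ => g x) ↔
      φ.Realize (Sum.elim ((↑) : A → M) fun _ => x) := by
    intro x
    have := StrongHomClass.realize_formula g φ (v := Sum.elim ((↑) : A → M) fun _ => x)
    rwa [Sum.comp_elim] at this
  rw [Set.image_eq_range, mem_acl_range_iff]
  refine ⟨φ, (hfin.image g).subset fun y hy => ?_, (key c).2 hφ⟩
  obtain ⟨x, rfl⟩ := g.surjective y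
  exact ⟨x, (key x).1 hy, rfl⟩

theorem pairIso_iff {Q Q' : Set M} : PairIso L Q Q' ↔ ∃ g : M ≃[L] M, g '' Q = Q' := by
  constructor
  · rintro ⟨f⟩
    let g : M ≃[L] M :=
      { toEquiv := f.toEquiv
        map_fun' := fun h x => f.map_fun' (Sum.inl h) x
        map_rel' := fun r x => f.map_rel' (Sum.inl r) x }
    have hg : ∀ x, g x ∈ Q' ↔ x ∈ Q := fun x => f.map_rel' (Sum.inr PredSymb.P) ![x]
    refine ⟨g, Set.ext fun y => ⟨?_, fun hy => ?_⟩⟩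
    · rintro ⟨x, hx, rfl⟩
      exact (hg x).2 hx
    · obtain ⟨x, rfl⟩ := g.surjective y
      exact ⟨x, (hg x).1 hy, rfl⟩
  · rintro ⟨g, rfl⟩
    refine ⟨{ toEquiv := g.toEquiv, map_fun' := ?_, map_rel' := ?_ }⟩
    · rintro n (f | f) x
      · exact g.map_fun' f x
      · exact f.elim
    · rintro n (r | r) x
      · exact g.map_rel' r x
      · cases r
        exact g.injective.mem_set_image

/-- An isomorphism would pull a small basis over `Q'` back to a small spanning set over `Q`. -/
theorem not_pairIso_of_hasCodim {Q Q' : Set M}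
    (hQ : ∀ A : Set M, #A < #M → acl L (Q ∪ A) ≠ Set.univ) {κ : Cardinal.{w}} (hκ : κ < #M)
    (hQ' : HasCodim L Q' κ) : ¬ PairIso L Q Q' := by
  rw [pairIso_iff]
  rintro ⟨g, rfl⟩
  obtain ⟨B, rfl, hspan, -⟩ := hQ'
  refine hQ (g.symm '' B) (Cardinal.mk_image_le.trans_lt hκ) (Set.eq_univ_of_forall fun c => ?_)
  have := map_mem_acl g.symm (hspan ▸ Set.mem_univ (g c) : g c ∈ acl L (g '' Q ∪ B))
  rw [Set.image_union, Set.image_image] at this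
  simpa using this

end Isomorphism

end LovelyPairs

/-- `T` is the complete theory of an o-minimal `L`-structure on `ℝ` in which the order and the
addition are defined without parameters by formulas `lt` and `add` (for an expansion in the strict
sense, atomic formulas), and `(C, P)` is a monster model of the theory of lovely pairs of `T`. -/
theorem proposition5p8 {L : FirstOrder.Language.{u, v}} [L.Structure ℝ]
    (lt : L.Formula (Fin 2)) (add : L.Formula (Fin 3))
    (hlt : ∀ a b : ℝ, lt.Realize ![a, b] ↔ a < b)
    (hadd : ∀ a b c : ℝ, add.Realize ![a, b, c] ↔ a + b = c)
    (homin : LovelyPairs.IsOMinimal L ℝ)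
    {C : Type w} [L.Structure C] [C ⊨ L.completeTheory ℝ]
    (P : Set C) (hP : LovelyPairs.IsMonsterLovelyPair L P) :
    LovelyPairs.orbit L P ≠ LovelyPairs.elemClass L P ∧
    (∀ κ : Cardinal.{w}, ℵ₀ ≤ κ → κ < #C →
      ∃ P' : Set C, P ⊆ P' ∧ LovelyPairs.IsAlgClosedSet L P' ∧ LovelyPairs.HasCodim L P' κ) ∧
    (∀ P' : Set C, P ⊆ P' → LovelyPairs.IsAlgClosedSet L P' →
      (∃ κ : Cardinal.{w}, ℵ₀ ≤ κ ∧ κ < #C ∧ LovelyPairs.HasCodim L P' κ) →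
        LovelyPairs.IsCodense lt P' ∧ LovelyPairs.IsLovelyPair L P' ∧
          P' ∈ LovelyPairs.elemClass L P ∧ ¬ LovelyPairs.PairIso L P P') := by
  open LovelyPairs in
  -- The predicate is put on `C` itself, so that `L`- and `L_P`-definability concern the same type.
  let _ : predLang.Structure C := Pair.predStructure P
  have hpred : ∀ x, x ∈ P ↔ Structure.RelMap (L := predLang) PredSymb.P ![x] := fun x => Iff.rfl
  have hsat : IsSaturated (pairLang L) C := hP.saturated
  have hM : ℵ₀ < #C := hP.uncountable
  have hadd' : DefinesAddition add ℝ :=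
    { exists_right := fun a c => ⟨c - a, (hadd _ _ _).2 (by ring)⟩
      functional := fun a b c d h₁ h₂ => ((hadd _ _ _).1 h₁).symm.trans ((hadd _ _ _).1 h₂)
      right_cancel := fun a b c d h₁ h₂ =>
        add_right_cancel (((hadd _ _ _).1 h₁).trans ((hadd _ _ _).1 h₂).symm) }
  have hlt' : DefinesDenseOrder lt ℝ :=
    { irrefl := fun a h => lt_irrefl a ((hlt _ _).1 h)
      trans := fun a b c h₁ h₂ => (hlt _ _).2 (((hlt _ _).1 h₁).trans ((hlt _ _).1 h₂))
      dense := fun a b h => (exists_between ((hlt _ _).1 h)).imp fun c hc =>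
        ⟨(hlt _ _).2 hc.1, (hlt _ _).2 hc.2⟩ }
  have haddC : DefinesAddition add C := hadd'.transfer
  have hltC : DefinesDenseOrder lt C := hlt'.transfer
  have hex : HasExchange L C := hasExchange_of_isSaturated hpred hP.models hsat hM
  have hsmall : ∀ A : Set C, #A < #C → ∃ c, c ∉ acl L (A ∪ P) := fun A hA =>
    exists_notMem_acl_union hpred hP.models hsat hM hA
  have hspan : ∀ A : Set C, #A < #C → acl L (P ∪ A) ≠ Set.univ := by
    intro A hA h
    obtain ⟨c, hc⟩ := hsmall A hA
    rw [Set.union_comm, h] at hc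
    exact hc trivial
  have hrichP : IsRich L P := isRich_of_subset hpred hP.models hsat hM haddC subset_rfl
    hP.models.isAlgClosedSet fun A hA =>
      hsmall A ((Cardinal.lt_aleph0_iff_set_finite.2 hA).trans hM)
  have hcodim : ∀ κ : Cardinal.{w}, ℵ₀ ≤ κ → κ < #C →
      ∃ P' : Set C, P ⊆ P' ∧ IsAlgClosedSet L P' ∧ HasCodim L P' κ := fun κ _ hκ =>
    exists_isAlgClosedSet_hasCodim hex hspan hκ.le
  have hmain : ∀ P' : Set C, P ⊆ P' → IsAlgClosedSet L P' →
      (∃ κ : Cardinal.{w}, ℵ₀ ≤ κ ∧ κ < #C ∧ HasCodim L P' κ) →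
        IsCodense lt P' ∧ IsLovelyPair L P' ∧ P' ∈ elemClass L P ∧ ¬ PairIso L P P' := by
    rintro P' hPP' hcl ⟨κ, hκ, hκC, hκP'⟩
    have hrich : IsRich L P' := isRich_of_subset hpred hP.models hsat hM haddC hPP' hcl
      fun A hA => hκP'.exists_notMem_acl hκ hA
    exact ⟨hrich.isCodense hltC, hrich.isLovelyPair,
      elementarilyEquivalent_of_isRich hex hrichP hrich, not_pairIso_of_hasCodim hspan hκC hκP'⟩
  refine ⟨fun heq => ?_, hcodim, hmain⟩
  obtain ⟨P', hPP', hcl, hκ⟩ := hcodim ℵ₀ le_rfl hM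
  obtain ⟨-, -, hequiv, hniso⟩ := hmain P' hPP' hcl ⟨ℵ₀, le_rfl, hM, hκ⟩
  rw [← heq] at hequiv
  exact hniso (pairIso_iff.2 hequiv)
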